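/- **Proposition 2.1.** Let $N,d$ be integers with $2\le d<N$, and let $(u_n)$ be a bounded sequence of real-valued functions in $H^1(\mathbb R^N)$, i.e. $\sup_n\|u_n\|_{H^1(\mathbb R^N)}<\infty$. Assume that, for each $n$, after removal of a null set of $\mathbb R^N$, the function $u_n$ is * radially symmetric with respect to $(x_1,\dots,x_d)$, i.e. $u_n(x)=u_n(y)$ whenever $x_1^2+\dots+x_d^2=y_1^2+\dots+y_d^2$ and $x_i=y_i$ for all $i>d$; and * decreasing (not necessarily strictly) with respect to $|x_i|$ for each $i=d+1,\dots,N$, i.e. $u_n(y)\le u_n(x)$ whenever $x_j=y_j$ for all $j\ne i$ and $|x_i|\le|y_i|$. If $u_n\rightharpoonup u$ weakly in $H^1(\mathbb R^N)$ for some $u\in H^1(\mathbb R^N)$, then for every real $q$ with $2<q<\frac{2N}{N-2}$ all the $u_n$ and $u$ belong to $L^q(\mathbb R^N)$ and $u_n\to u$ strongly in $L^q(\mathbb R^N)$. -/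

import Mathlib

open MeasureTheory Filter Topology
open scoped ContDiff ENNReal

noncomputable section

/-- The real Lebesgue space `L²(ℝ^N)`. -/
abbrev L2Space (N : ℕ) : Type :=
  Lp ℝ 2 (volume : Measure (EuclideanSpace ℝ (Fin N)))

/-- `g` is the weak (distributional) partial derivative `∂f/∂x_i` on `ℝ^N`:
`∫ f ∂_i φ = - ∫ g φ` for every test function `φ ∈ C_c^∞(ℝ^N)`.
It is used below only for `f, g ∈ L²(ℝ^N)`, where both integrals converge. -/
def HasWeakPartialDeriv {N : ℕ} (i : Fin N) (f g : EuclideanSpace ℝ (Fin N) → ℝ) : Prop :=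
  ∀ φ : EuclideanSpace ℝ (Fin N) → ℝ, ContDiff ℝ ∞ φ → HasCompactSupport φ →
    ∫ x, f x * fderiv ℝ φ x (EuclideanSpace.single i 1) = - ∫ x, g x * φ x

theorem L2Space.integrable_mul {N : ℕ} (f : L2Space N) {ψ : EuclideanSpace ℝ (Fin N) → ℝ}
    (hψ : Continuous ψ) (hc : HasCompactSupport ψ) : Integrable (fun x => f x * ψ x) :=
  ((Lp.memLp f).locallyIntegrable (by norm_num)).integrable_smul_right_of_hasCompactSupport hψ hc

theorem continuous_partialDeriv {N : ℕ} (i : Fin N) {φ : EuclideanSpace ℝ (Fin N) → ℝ}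
    (hφ : ContDiff ℝ ∞ φ) :
    Continuous (fun x => fderiv ℝ φ x (EuclideanSpace.single i 1)) :=
  (hφ.continuous_fderiv (by simp)).clm_apply continuous_const

theorem hasCompactSupport_partialDeriv {N : ℕ} (i : Fin N)
    {φ : EuclideanSpace ℝ (Fin N) → ℝ} (hc : HasCompactSupport φ) :
    HasCompactSupport (fun x => fderiv ℝ φ x (EuclideanSpace.single i 1)) :=
  hc.fderiv_apply ℝ _

/-- The Sobolev space `H¹(ℝ^N)` of real functions, realized as the subspace
`{(f, (g_i)_i) : g_i = ∂f/∂x_i weakly}` of `L² × (L²)^N` with the inherited Hilbert norm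
`‖f‖² = ‖f‖_{L²}² + ∑ i, ‖∂_i f‖_{L²}²`. (Weak derivatives are unique, so an element is
determined by its first component.) -/
def sobolevH1 (N : ℕ) :
    Submodule ℝ (WithLp 2 (L2Space N × PiLp 2 (fun _ : Fin N => L2Space N))) where
  carrier := {p | ∀ i : Fin N, HasWeakPartialDeriv i (p.fst : EuclideanSpace ℝ (Fin N) → ℝ)
    (p.snd i : EuclideanSpace ℝ (Fin N) → ℝ)}
  zero_mem' := by
    intro i φ _ _
    simp
  add_mem' := by
    intro p r hp hr i φ hφ hc
    have key : ∀ (a b : L2Space N) {ψ : EuclideanSpace ℝ (Fin N) → ℝ}, Continuous ψ →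
        HasCompactSupport ψ →
        ∫ x, (a + b) x * ψ x = (∫ x, a x * ψ x) + ∫ x, b x * ψ x := by
      intro a b ψ h1 h2
      rw [← integral_add (a.integrable_mul h1 h2) (b.integrable_mul h1 h2)]
      refine integral_congr_ae ?_
      filter_upwards [Lp.coeFn_add a b] with x hx
      rw [hx, Pi.add_apply, add_mul]
    have e1 := key p.fst r.fst (continuous_partialDeriv i hφ)
      (hasCompactSupport_partialDeriv i hc)
    have e2 := key (p.snd i) (r.snd i) hφ.continuous hc
    have h1 := hp i φ hφ hc
    have h2 := hr i φ hφ hc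
    change ∫ x, (p.fst + r.fst) x * _ = - ∫ x, (p.snd i + r.snd i) x * φ x
    rw [e1, e2, h1, h2]
    ring
  smul_mem' := by
    intro c p hp i φ hφ hc
    have key : ∀ (a : L2Space N) (ψ : EuclideanSpace ℝ (Fin N) → ℝ),
        ∫ x, (c • a) x * ψ x = c * ∫ x, a x * ψ x := by
      intro a ψ
      rw [← integral_const_mul]
      refine integral_congr_ae ?_
      filter_upwards [Lp.coeFn_smul c a] with x hx
      rw [hx, Pi.smul_apply, smul_eq_mul, mul_assoc]
    have h1 := hp i φ hφ hc
    change ∫ x, (c • p.fst) x * _ = - ∫ x, (c • p.snd i) x * φ x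
    rw [key, key, h1]
    ring

/-- `H¹(ℝ^N)` as a normed space. -/
abbrev H1Space (N : ℕ) : Type := sobolevH1 N

/-- The function `ℝ^N → ℝ` (defined up to null sets) underlying an element of `H¹(ℝ^N)`. -/
def H1Space.toFun {N : ℕ} (u : H1Space N) : EuclideanSpace ℝ (Fin N) → ℝ :=
  (u.1.fst : L2Space N)

/-- On the set `S`, the function `f` is radially symmetric with respect to `(x_1, …, x_d)`:
its value depends only on `|(x_1, …, x_d)|` and on the remaining coordinates. -/
def RadialFirstOn {N : ℕ} (d : ℕ) (S : Set (EuclideanSpace ℝ (Fin N)))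
    (f : EuclideanSpace ℝ (Fin N) → ℝ) : Prop :=
  ∀ x ∈ S, ∀ y ∈ S,
    (∑ i : Fin N with i.val < d, x i ^ 2) = (∑ i : Fin N with i.val < d, y i ^ 2) →
    (∀ i : Fin N, d ≤ i.val → x i = y i) → f x = f y

/-- On the set `S`, the function `f` is (not necessarily strictly) decreasing with respect to
`|x_i|`, the other coordinates being fixed. In particular it is even in `x_i`. -/
def DecreasingAbsOn {N : ℕ} (i : Fin N) (S : Set (EuclideanSpace ℝ (Fin N)))
    (f : EuclideanSpace ℝ (Fin N) → ℝ) : Prop :=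
  ∀ x ∈ S, ∀ y ∈ S, (∀ j : Fin N, j ≠ i → x j = y j) → |x i| ≤ |y i| → f y ≤ f x

/-- The symmetry hypothesis for an almost-everywhere class `f`: off a null set, `f` is radially
symmetric with respect to `(x_1, …, x_d)` and decreasing with respect to each `|x_i|`, `i > d`.
(Real functions with the properties everywhere are included, with `S = univ`; a null set
has to be allowed because an unbounded Sobolev function such as a decreasing singularity
along a subspace may take no finite value there.) -/
def IsPartiallySymmetric {N : ℕ} (d : ℕ) (f : EuclideanSpace ℝ (Fin N) → ℝ) : Prop :=
  ∃ S : Set (EuclideanSpace ℝ (Fin N)), volume Sᶜ = 0 ∧ RadialFirstOn d S f ∧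
    ∀ i : Fin N, d ≤ i.val → DecreasingAbsOn i S f

/-- Weak convergence `u_n ⇀ u` in `H¹(ℝ^N)`: convergence against every bounded linear
functional. -/
def H1WeakTendsto {N : ℕ} (u : ℕ → H1Space N) (v : H1Space N) : Prop :=
  ∀ l : H1Space N →L[ℝ] ℝ, Tendsto (fun n => l (u n)) atTop (𝓝 (l v))

end

/-!
The proof compares each function `f` with its averages `f_r` over balls of radius `r`, and needs
neither the Rellich theorem nor the critical Sobolev inequality.

* *Translations.* An `H¹` function satisfies `‖f(· + h) - f‖₂ ≤ N ‖f‖_{H¹} ‖h‖`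
  (`H1Space.eLpNorm_translate_sub_le`). This is the only way in which derivatives enter.
* *Averages approximate in `L^q`.* The translation estimate gives `‖f_r - f_{r/2}‖₂ ≲ r` and
  `‖f_r - f_{r/2}‖_∞ ≲ r ^ (1 - N/2)`, hence by interpolation
  `‖f_r - f_{r/2}‖_q ≲ r ^ (1 - N/2 + N/q)`. The exponent is positive exactly below the Sobolev
  exponent, so summing over dyadic radii gives `‖f_r - f‖_q → 0` as `r = 2⁻ᵐ → 0`, uniformly on
  bounded sets of `H¹` (`exists_eLpNorm_ballAverage_sub_le`).
* *Decay.* For fixed `r`, `|f_r(x)|² ≲ ∫_{B(x,r)} |f|²`, and the symmetry of `f` makes the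
  integral at most `2 ‖f‖₂² / k` when `x` is far out: rotations in the first `d ≥ 2` coordinates,
  or translations along a coordinate in which `f` is monotone, give `k` disjoint balls on which
  there is at least as much mass (`IsPartiallySymmetric.mul_setLIntegral_ball_le`).
* *Averages converge.* For fixed `r`, weak convergence gives `(u_n)_r → v_r` pointwise. The
  pointwise bounds on `(u_n)_r`, including the decay, pass to the limit `v_r`, so `v` itself need
  not be known to be symmetric. Dominated convergence on a large ball and the decay outside it
  give `(u_n)_r → v_r` in `L^q` (`tendsto_eLpNorm_ballAverage_sub`).
-/

/-! ### Translation estimate in `H¹` -/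

theorem H1Space.norm_fst_le {N : ℕ} (u : H1Space N) : ‖(u.1.fst : L2Space N)‖ ≤ ‖u‖ :=
  WithLp.norm_fst_le _ u.1

theorem H1Space.norm_snd_apply_le {N : ℕ} (u : H1Space N) (i : Fin N) :
    ‖(u.1.snd i : L2Space N)‖ ≤ ‖u‖ :=
  (PiLp.norm_apply_le u.1.snd i).trans (WithLp.norm_snd_le _ u.1)

theorem L2Space.abs_integral_mul_le {N : ℕ} (f g : L2Space N) :
    |∫ x, f x * g x| ≤ ‖f‖ * ‖g‖ := by
  have h := abs_real_inner_le_norm g f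
  rw [L2.inner_def] at h
  simpa [mul_comm] using h

/-- Differentiating `t ↦ ∫ f(x) φ(x - t h) dx` puts the derivative on `φ`, and the definition of
weak derivatives moves it to `f`. -/
theorem H1Space.hasDerivAt_integral_mul_translate {N : ℕ} (u : H1Space N)
    {φ : EuclideanSpace ℝ (Fin N) → ℝ} (hφ : ContDiff ℝ ∞ φ) (hc : HasCompactSupport φ)
    (h : EuclideanSpace ℝ (Fin N)) (t : ℝ) :
    HasDerivAt (fun t : ℝ => ∫ x, u.toFun x * φ (x - t • h))
      (∑ i, h i * ∫ x, (u.1.snd i : L2Space N) x * φ (x - t • h)) t := by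
  -- The integral is the convolution of `f` with the reflection of `φ`, at the point `t • h`.
  set ψ : EuclideanSpace ℝ (Fin N) → ℝ := fun x => φ (-x) with hψ
  have hψs : ContDiff ℝ ∞ ψ := hφ.comp contDiff_neg
  have hψc : HasCompactSupport ψ := hc.comp_homeomorph (Homeomorph.neg _)
  have hli : LocallyIntegrable (u.toFun) volume :=
    (Lp.memLp (u.1.fst : L2Space N)).locallyIntegrable (by norm_num)
  have h1 := hψc.hasFDerivAt_convolution_right (ContinuousLinearMap.mul ℝ ℝ) hli
    (hψs.of_le (by simp)) (t • h)
  have h2 : HasDerivAt (fun t : ℝ => t • h) h t := by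
    simpa using (hasDerivAt_id t).smul_const h
  have h3 := h1.comp_hasDerivAt t h2
  have hfd : ∀ z, fderiv ℝ ψ z h = - fderiv ℝ φ (-z) h := by
    intro z
    have h4 : HasFDerivAt ψ ((fderiv ℝ φ (-z)).comp (-ContinuousLinearMap.id ℝ _)) z :=
      ((hφ.differentiable (by simp)).differentiableAt.hasFDerivAt).comp z (hasFDerivAt_id z).neg
    rw [h4.fderiv]
    simp
  have e1 : (convolution u.toFun ψ (ContinuousLinearMap.mul ℝ ℝ) volume ∘ fun t : ℝ => t • h) =
      fun t : ℝ => ∫ x, u.toFun x * φ (x - t • h) := by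
    funext s
    simp [convolution_def, hψ]
  rw [e1, convolution_precompR_apply _ hli (hψc.fderiv ℝ) (hψs.continuous_fderiv (by simp))] at h3
  refine h3.congr_deriv (Eq.symm ?_)
  simp only [convolution_def, hfd, ContinuousLinearMap.mul_apply', neg_sub]
  set φt : EuclideanSpace ℝ (Fin N) → ℝ := fun x => φ (x - t • h) with hφt
  have hφts : ContDiff ℝ ∞ φt := hφ.comp (contDiff_id.sub contDiff_const)
  have hφtc : HasCompactSupport φt := by
    have := hc.comp_homeomorph (Homeomorph.addRight (-(t • h)))
    simpa [hφt, Function.comp_def, sub_eq_add_neg] using this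
  have hfdt : ∀ x, fderiv ℝ φ (x - t • h) h
      = ∑ i, h i * fderiv ℝ φt x (EuclideanSpace.single i 1) := by
    intro x
    have : fderiv ℝ φt x = fderiv ℝ φ (x - t • h) := by
      rw [hφt, fderiv_comp_sub]
    rw [this]
    generalize x - t • h = y
    conv_lhs => rw [← (EuclideanSpace.basisFun (Fin N) ℝ).sum_repr h]
    simp
  have hw := fun i => u.2 i φt hφts hφtc
  have hint : ∀ i, Integrable (fun x => u.toFun x * fderiv ℝ φt x (EuclideanSpace.single i 1)) :=
    fun i => L2Space.integrable_mul u.1.fst (continuous_partialDeriv i hφts)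
      (hasCompactSupport_partialDeriv i hφtc)
  calc ∑ i, h i * ∫ x, (u.1.snd i : L2Space N) x * φt x
      = - ∑ i, h i * ∫ x, u.toFun x * fderiv ℝ φt x (EuclideanSpace.single i 1) := by
        rw [← Finset.sum_neg_distrib]
        refine Finset.sum_congr rfl fun i _ => ?_
        have := hw i
        unfold H1Space.toFun
        rw [this]; ring
    _ = - ∫ x, ∑ i, h i * (u.toFun x * fderiv ℝ φt x (EuclideanSpace.single i 1)) := by
        rw [integral_finsetSum _ fun i _ => (hint i).const_mul _]
        simp_rw [integral_const_mul]
    _ = ∫ x, u.toFun x * -fderiv ℝ φ (x - t • h) h := by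
        rw [← integral_neg]
        refine integral_congr_ae (Eventually.of_forall fun x => ?_)
        simp only [hfdt, mul_neg, neg_inj, Finset.mul_sum]
        exact Finset.sum_congr rfl fun i _ => by ring

/-- The translation estimate `‖f(· + h) - f‖₂ ≤ C ‖h‖` tested against a smooth function: the
mean value inequality along `t ↦ ∫ f(x + t h) φ(x) dx`. -/
theorem H1Space.abs_integral_translate_sub_mul_le {N : ℕ} (u : H1Space N)
    {φ : EuclideanSpace ℝ (Fin N) → ℝ} (hφ : ContDiff ℝ ∞ φ) (hc : HasCompactSupport φ)
    (p : L2Space N) (hp : p =ᵐ[volume] φ) (h : EuclideanSpace ℝ (Fin N)) :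
    |(∫ x, u.toFun x * φ (x - h)) - ∫ x, u.toFun x * φ x| ≤ N * ‖u‖ * ‖h‖ * ‖p‖ := by
  have hder := u.hasDerivAt_integral_mul_translate hφ hc h
  have hb : ∀ t : ℝ, ‖∑ i, h i * ∫ x, (u.1.snd i : L2Space N) x * φ (x - t • h)‖
      ≤ N * ‖u‖ * ‖h‖ * ‖p‖ := by
    intro t
    have hmp : MeasurePreserving (fun x : EuclideanSpace ℝ (Fin N) => x - t • h) :=
      measurePreserving_sub_right volume (t • h)
    have hpt : (Lp.compMeasurePreserving _ hmp p : L2Space N) =ᵐ[volume]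
        fun x => φ (x - t • h) :=
      (Lp.coeFn_compMeasurePreserving p hmp).trans (hmp.quasiMeasurePreserving.ae_eq_comp hp)
    have hpn : ‖Lp.compMeasurePreserving _ hmp p‖ = ‖p‖ := Lp.norm_compMeasurePreserving p hmp
    calc ‖∑ i, h i * ∫ x, (u.1.snd i : L2Space N) x * φ (x - t • h)‖
        ≤ ∑ i : Fin N, ‖u‖ * ‖h‖ * ‖p‖ := by
          refine norm_sum_le_of_le _ fun i _ => ?_
          rw [norm_mul]
          have h1 : ‖∫ x, (u.1.snd i : L2Space N) x * φ (x - t • h)‖ ≤ ‖u‖ * ‖p‖ := by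
            have e : ∫ x, (u.1.snd i : L2Space N) x * φ (x - t • h)
                = ∫ x, (u.1.snd i : L2Space N) x * Lp.compMeasurePreserving _ hmp p x := by
              refine integral_congr_ae ?_
              filter_upwards [hpt] with x hx
              rw [hx]
            rw [e, Real.norm_eq_abs]
            refine (L2Space.abs_integral_mul_le _ _).trans ?_
            rw [hpn]
            gcongr
            exact u.norm_snd_apply_le i
          calc ‖h i‖ * _ ≤ ‖h‖ * (‖u‖ * ‖p‖) := by
                gcongr
                exact PiLp.norm_apply_le h i
            _ = _ := by ring
      _ = N * ‖u‖ * ‖h‖ * ‖p‖ := by simp; ring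
  have := norm_image_sub_le_of_norm_deriv_le_segment_01'
    (fun t _ => (hder t).hasDerivWithinAt) (fun t _ => hb t)
  simpa using this

/-- Obtained from the estimate against smooth functions by duality, as these are dense in `L²`. -/
theorem H1Space.eLpNorm_translate_sub_le {N : ℕ} (u : H1Space N)
    (h : EuclideanSpace ℝ (Fin N)) :
    eLpNorm (fun x => u.toFun (x + h) - u.toFun x) 2 volume
      ≤ ENNReal.ofReal (N * ‖u‖ * ‖h‖) := by
  have hmp : MeasurePreserving (fun x : EuclideanSpace ℝ (Fin N) => x + h) :=
    measurePreserving_add_right volume h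
  set f : L2Space N := u.1.fst with hf
  set w : L2Space N := Lp.compMeasurePreserving _ hmp f - f with hwdef
  have hw : w =ᵐ[volume] fun x => u.toFun (x + h) - u.toFun x := by
    filter_upwards [Lp.coeFn_sub (Lp.compMeasurePreserving _ hmp f) f,
      Lp.coeFn_compMeasurePreserving f hmp] with x h1 h2
    rw [h1, Pi.sub_apply, h2]
    rfl
  rw [← eLpNorm_congr_ae hw]
  have key : ∀ p : L2Space N, inner ℝ p w ≤ N * ‖u‖ * ‖h‖ * ‖p‖ := by
    have hcl : IsClosed {p : L2Space N | inner ℝ p w ≤ N * ‖u‖ * ‖h‖ * ‖p‖} :=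
      isClosed_le (by fun_prop) (by fun_prop)
    have hd := Lp.dense_hasCompactSupport_contDiff (E := EuclideanSpace ℝ (Fin N)) (F := ℝ)
      (μ := volume) (p := 2) (by norm_num)
    intro p
    refine (hcl.closure_subset_iff.2 ?_) (hd p)
    rintro p ⟨φ, hpφ, hc, hφ⟩
    have hb := u.abs_integral_translate_sub_mul_le hφ hc p hpφ h
    have e : inner ℝ p w = (∫ x, u.toFun x * φ (x - h)) - ∫ x, u.toFun x * φ x := by
      have e1 : ∫ x, u.toFun x * φ (x - h) = ∫ x, u.toFun (x + h) * φ x := by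
        rw [← integral_add_right_eq_self _ h]
        simp
      have hi1 : Integrable (fun x => u.toFun (x + h) * φ x) := by
        refine (L2Space.integrable_mul (Lp.compMeasurePreserving _ hmp f) hφ.continuous hc).congr ?_
        filter_upwards [Lp.coeFn_compMeasurePreserving f hmp] with x h2
        rw [h2]; rfl
      have hi2 : Integrable (fun x => u.toFun x * φ x) :=
        L2Space.integrable_mul f hφ.continuous hc
      rw [e1, ← integral_sub hi1 hi2, L2.inner_def]
      refine integral_congr_ae ?_
      filter_upwards [hw, hpφ] with x h1 h2
      simp [h1, h2]
      ring
    change inner ℝ p w ≤ _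
    rw [e]
    exact (le_abs_self _).trans hb
  have hK : 0 ≤ N * ‖u‖ * ‖h‖ := by positivity
  have hn : ‖w‖ ≤ N * ‖u‖ * ‖h‖ := by
    have := key w
    rw [real_inner_self_eq_norm_mul_norm] at this
    rcases (norm_nonneg w).eq_or_lt with h0 | h0
    · rw [← h0]; exact hK
    · exact le_of_mul_le_mul_right this h0
  rw [← Lp.enorm_def, ← ofReal_norm]
  exact ENNReal.ofReal_le_ofReal hn

/-! ### Averages over balls -/

section Average

theorem eLpNorm_two_sq {α : Type*} [MeasurableSpace α] {μ : Measure α} (g : α → ℝ) :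
    eLpNorm g 2 μ ^ 2 = ∫⁻ x, ‖g x‖ₑ ^ 2 ∂μ := by
  simpa using eLpNorm_nnreal_pow_eq_lintegral (f := g) (μ := μ) (p := 2) (by norm_num)

theorem enorm_integral_sq_le {α : Type*} [MeasurableSpace α] {μ : Measure α} {g : α → ℝ}
    (hg : AEStronglyMeasurable g μ) :
    ‖∫ x, g x ∂μ‖ₑ ^ 2 ≤ μ Set.univ * ∫⁻ x, ‖g x‖ₑ ^ 2 ∂μ := by
  have h1 := eLpNorm_le_eLpNorm_mul_rpow_measure_univ (p := 1) (q := 2) (by norm_num) hg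
  rw [eLpNorm_one_eq_lintegral_enorm] at h1
  calc ‖∫ x, g x ∂μ‖ₑ ^ 2 ≤ (eLpNorm g 2 μ * μ Set.univ ^ (1 / 2 : ℝ)) ^ 2 := by
        gcongr
        refine (enorm_integral_le_lintegral_enorm g).trans (h1.trans_eq ?_)
        norm_num
    _ = μ Set.univ * ∫⁻ x, ‖g x‖ₑ ^ 2 ∂μ := by
        rw [mul_pow, eLpNorm_two_sq, mul_comm, ← ENNReal.rpow_natCast (μ Set.univ ^ _),
          ← ENNReal.rpow_mul]
        norm_num

theorem enorm_average_sq_le {α : Type*} [MeasurableSpace α] {μ : Measure α} {g : α → ℝ}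
    (hg : AEStronglyMeasurable g μ) :
    ‖⨍ x, g x ∂μ‖ₑ ^ 2 ≤ (μ Set.univ)⁻¹ * ∫⁻ x, ‖g x‖ₑ ^ 2 ∂μ := by
  rw [average]
  refine (enorm_integral_sq_le (hg.smul_measure _)).trans ?_
  rw [lintegral_smul_measure]
  simp only [Measure.smul_apply, smul_eq_mul]
  refine mul_le_of_le_one_left' ?_
  exact ENNReal.inv_mul_le_one _

/-- The average of `f` over the ball of radius `r` around `x`, written as an average of
translates `f (x + h)` over `‖h‖ < r`. -/
noncomputable def ballAverage {E : Type*} [NormedAddCommGroup E] [MeasurableSpace E]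
    (μ : Measure E) (f : E → ℝ) (r : ℝ) (x : E) : ℝ :=
  ⨍ h in Metric.ball (0 : E) r, f (x + h) ∂μ

variable {E : Type*} [NormedAddCommGroup E] [MeasurableSpace E] [BorelSpace E]
  {μ : Measure E} [μ.IsAddHaarMeasure] {f : E → ℝ} {r s : ℝ}

theorem setIntegral_ball_zero_add (x : E) :
    ∫ h in Metric.ball (0 : E) r, f (x + h) ∂μ = ∫ y in Metric.ball x r, f y ∂μ := by
  have := (measurePreserving_add_left μ x).setIntegral_preimage_emb
    (measurableEmbedding_addLeft x) f (Metric.ball x r)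
  rw [← this]
  congr 2
  simp [preimage_add_ball]

theorem setLIntegral_ball_zero_add (g : E → ℝ≥0∞) (x : E) :
    ∫⁻ h in Metric.ball (0 : E) r, g (x + h) ∂μ = ∫⁻ y in Metric.ball x r, g y ∂μ := by
  have := (measurePreserving_add_left μ x).setLIntegral_comp_preimage_emb
    (measurableEmbedding_addLeft x) g (Metric.ball x r)
  rw [← this]
  congr 2
  simp [preimage_add_ball]

theorem ballAverage_eq (x : E) :
    ballAverage μ f r x = (μ.real (Metric.ball 0 r))⁻¹ * ∫ y in Metric.ball x r, f y ∂μ := by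
  rw [ballAverage, setAverage_eq, setIntegral_ball_zero_add, smul_eq_mul]

theorem enorm_ballAverage_sq_le (hf : StronglyMeasurable f) (x : E) :
    ‖ballAverage μ f r x‖ₑ ^ 2
      ≤ (μ (Metric.ball 0 r))⁻¹ * ∫⁻ y in Metric.ball x r, ‖f y‖ₑ ^ 2 ∂μ := by
  have h1 : StronglyMeasurable (fun h => f (x + h)) :=
    hf.comp_measurable (measurable_const_add x)
  refine (enorm_average_sq_le h1.aestronglyMeasurable).trans_eq ?_
  rw [setLIntegral_ball_zero_add (fun y => ‖f y‖ₑ ^ 2), Measure.restrict_apply_univ]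

variable [NormedSpace ℝ E] [FiniteDimensional ℝ E]

theorem stronglyMeasurable_ballAverage (hf : StronglyMeasurable f) :
    StronglyMeasurable (ballAverage μ f r) := by
  unfold ballAverage average
  refine StronglyMeasurable.integral_prod_right (f := fun x h => f (x + h)) ?_
  exact hf.comp_measurable measurable_add

theorem enorm_ballAverage_sub_sq_le (hf : StronglyMeasurable f) (hfi : LocallyIntegrable f μ)
    (hr : 0 < r) (x : E) (c : ℝ) :
    ‖ballAverage μ f r x - c‖ₑ ^ 2
      ≤ (μ (Metric.ball 0 r))⁻¹ * ∫⁻ h in Metric.ball 0 r, ‖f (x + h) - c‖ₑ ^ 2 ∂μ := by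
  have h1 : StronglyMeasurable (fun h => f (x + h)) :=
    hf.comp_measurable (measurable_const_add x)
  have h0 : μ (Metric.ball (0 : E) r) ≠ 0 := (Metric.measure_ball_pos μ 0 hr).ne'
  have ht : μ (Metric.ball (0 : E) r) ≠ ⊤ := measure_ball_lt_top.ne
  have hint : IntegrableOn (fun h => f (x + h)) (Metric.ball 0 r) μ := by
    have h2 := (measurePreserving_add_left μ x).integrableOn_comp_preimage
      (measurableEmbedding_addLeft x) (f := f) (s := Metric.ball x r)
    have h3 : (fun h => x + h) ⁻¹' Metric.ball x r = Metric.ball 0 r := by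
      simp [preimage_add_ball]
    rw [h3] at h2
    exact h2.2 (((hfi.integrableOn_isCompact (isCompact_closedBall x r))).mono_set
      Metric.ball_subset_closedBall)
  have e : ballAverage μ f r x - c = ⨍ h in Metric.ball (0 : E) r, (f (x + h) - c) ∂μ := by
    rw [setAverage_eq, integral_sub hint (integrableOn_const ht), smul_sub, ballAverage,
      setAverage_eq]
    congr 1
    rw [setIntegral_const, smul_smul, inv_mul_cancel₀, one_smul]
    simp [Measure.real, ENNReal.toReal_eq_zero_iff, h0, ht]
  rw [e]
  refine (enorm_average_sq_le (h1.aestronglyMeasurable.sub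
    aestronglyMeasurable_const)).trans_eq ?_
  rw [Measure.restrict_apply_univ]
  rfl

/-- The increments of `f` over translations of length at most `r`, integrated over all base points
and all translations. -/
theorem lintegral_translates_sub_le (hf : StronglyMeasurable f) {K : ℝ≥0∞}
    (hK : ∀ h, ∫⁻ x, ‖f (x + h) - f x‖ₑ ^ 2 ∂μ ≤ (K * ‖h‖ₑ) ^ 2) :
    ∫⁻ x, ∫⁻ h in Metric.ball 0 r, ‖f (x + h) - f x‖ₑ ^ 2 ∂μ ∂μ
      ≤ μ (Metric.ball 0 r) * (K * ENNReal.ofReal r) ^ 2 := by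
  have hm : Measurable (fun p : E × E => ‖f (p.1 + p.2) - f p.1‖ₑ ^ 2) :=
    ((hf.measurable.comp measurable_add).sub (hf.measurable.comp measurable_fst)).enorm.pow_const 2
  rw [lintegral_lintegral_swap hm.aemeasurable, mul_comm, ← setLIntegral_const]
  refine setLIntegral_mono measurable_const fun h hh => (hK h).trans ?_
  have : ‖h‖ₑ ≤ ENNReal.ofReal r := by
    rw [← ofReal_norm]
    exact ENNReal.ofReal_le_ofReal (by simpa using (mem_ball_zero_iff.1 hh).le)
  gcongr

theorem lintegral_ballAverage_sub_sq_le (hf : StronglyMeasurable f)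
    (hfi : LocallyIntegrable f μ) {K : ℝ≥0∞}
    (hK : ∀ h, ∫⁻ x, ‖f (x + h) - f x‖ₑ ^ 2 ∂μ ≤ (K * ‖h‖ₑ) ^ 2) (hr : 0 < r) :
    ∫⁻ x, ‖ballAverage μ f r x - f x‖ₑ ^ 2 ∂μ ≤ (K * ENNReal.ofReal r) ^ 2 := by
  have h0 : μ (Metric.ball (0 : E) r) ≠ 0 := (Metric.measure_ball_pos μ 0 hr).ne'
  have ht : μ (Metric.ball (0 : E) r) ≠ ⊤ := measure_ball_lt_top.ne
  calc _ ≤ ∫⁻ x, (μ (Metric.ball 0 r))⁻¹ *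
          ∫⁻ h in Metric.ball 0 r, ‖f (x + h) - f x‖ₑ ^ 2 ∂μ ∂μ :=
        lintegral_mono fun x => enorm_ballAverage_sub_sq_le hf hfi hr x (f x)
    _ = (μ (Metric.ball 0 r))⁻¹ *
          ∫⁻ x, ∫⁻ h in Metric.ball 0 r, ‖f (x + h) - f x‖ₑ ^ 2 ∂μ ∂μ :=
        lintegral_const_mul' _ _ (ENNReal.inv_ne_top.2 h0)
    _ ≤ (μ (Metric.ball 0 r))⁻¹ * (μ (Metric.ball 0 r) * (K * ENNReal.ofReal r) ^ 2) := by
        gcongr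
        exact lintegral_translates_sub_le hf hK
    _ = _ := by rw [← mul_assoc, ENNReal.inv_mul_cancel h0 ht, one_mul]

/-- Two averages around the same point differ by at most `r ^ (1 - dim E / 2)`, up to a constant,
when the radii are comparable to `r`. Averaging over both balls is what makes the increment
`f (y + w) - f y` appear with both `y` and `w` integrated. -/
theorem enorm_ballAverage_sub_ballAverage_sq_le (hf : StronglyMeasurable f)
    (hfi : LocallyIntegrable f μ) {K : ℝ≥0∞}
    (hK : ∀ h, ∫⁻ x, ‖f (x + h) - f x‖ₑ ^ 2 ∂μ ≤ (K * ‖h‖ₑ) ^ 2) (hr : 0 < r) (hs : 0 < s)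
    (x : E) :
    ‖ballAverage μ f r x - ballAverage μ f s x‖ₑ ^ 2
      ≤ (μ (Metric.ball 0 r))⁻¹ * ((μ (Metric.ball 0 s))⁻¹ *
        (μ (Metric.ball 0 (r + s)) * (K * ENNReal.ofReal (r + s)) ^ 2)) := by
  have h0 : μ (Metric.ball (0 : E) s) ≠ 0 := (Metric.measure_ball_pos μ 0 hs).ne'
  have hsub : ∀ h ∈ Metric.ball (0 : E) r,
      ∫⁻ k in Metric.ball 0 s, ‖f (x + k) - f (x + h)‖ₑ ^ 2 ∂μ
        ≤ ∫⁻ w in Metric.ball 0 (r + s), ‖f ((x + h) + w) - f (x + h)‖ₑ ^ 2 ∂μ := by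
    intro h hh
    have e1 : ∫⁻ w in Metric.ball 0 (r + s), ‖f ((x + h) + w) - f (x + h)‖ₑ ^ 2 ∂μ
        = ∫⁻ k in Metric.ball h (r + s), ‖f (x + k) - f (x + h)‖ₑ ^ 2 ∂μ := by
      rw [← setLIntegral_ball_zero_add (fun k => ‖f (x + k) - f (x + h)‖ₑ ^ 2) h]
      simp only [add_assoc]
    rw [e1]
    refine lintegral_mono_set fun k hk => ?_
    rw [mem_ball_zero_iff] at hh hk
    rw [mem_ball_iff_norm]
    linarith [norm_sub_le k h]
  calc _ ≤ (μ (Metric.ball 0 r))⁻¹ * ∫⁻ h in Metric.ball 0 r,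
          ‖f (x + h) - ballAverage μ f s x‖ₑ ^ 2 ∂μ :=
        enorm_ballAverage_sub_sq_le hf hfi hr x _
    _ ≤ (μ (Metric.ball 0 r))⁻¹ * ∫⁻ h in Metric.ball 0 r, (μ (Metric.ball 0 s))⁻¹ *
          ∫⁻ w in Metric.ball 0 (r + s), ‖f ((x + h) + w) - f (x + h)‖ₑ ^ 2 ∂μ ∂μ := by
        refine mul_le_mul_right ?_ _
        refine setLIntegral_mono' measurableSet_ball fun h hh => ?_
        rw [← enorm_neg, neg_sub]
        refine (enorm_ballAverage_sub_sq_le hf hfi hs x _).trans ?_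
        refine mul_le_mul_right ?_ _
        exact hsub h hh
    _ = (μ (Metric.ball 0 r))⁻¹ * ((μ (Metric.ball 0 s))⁻¹ * ∫⁻ h in Metric.ball 0 r,
          ∫⁻ w in Metric.ball 0 (r + s), ‖f ((x + h) + w) - f (x + h)‖ₑ ^ 2 ∂μ ∂μ) := by
        rw [lintegral_const_mul' _ _ (ENNReal.inv_ne_top.2 h0)]
    _ ≤ _ := by
        refine mul_le_mul_right (mul_le_mul_right ?_ _) _
        refine (setLIntegral_le_lintegral _ _).trans ?_
        rw [lintegral_add_left_eq_self
          (fun y => ∫⁻ w in Metric.ball 0 (r + s), ‖f (y + w) - f y‖ₑ ^ 2 ∂μ) x]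
        exact lintegral_translates_sub_le hf hK

/-- Interpolation between `L^∞` and `L²`. -/
theorem eLpNorm_le_of_ae_enorm_le {α : Type*} [MeasurableSpace α] {μ : Measure α} {g : α → ℝ}
    {M : ℝ≥0∞} (hMt : M ≠ ⊤) (hM : ∀ᵐ x ∂μ, ‖g x‖ₑ ≤ M) {q : ℝ} (hq : 2 < q) :
    eLpNorm g (ENNReal.ofReal q) μ ≤ M ^ (1 - 2 / q) * eLpNorm g 2 μ ^ (2 / q) := by
  have hq0 : 0 < q := by linarith
  have h2 : eLpNorm g 2 μ ^ (2 : ℝ) = ∫⁻ x, ‖g x‖ₑ ^ (2 : ℝ) ∂μ := by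
    simpa using eLpNorm_nnreal_pow_eq_lintegral (f := g) (μ := μ) (p := 2) (by norm_num)
  rw [eLpNorm_eq_lintegral_rpow_enorm_toReal (by simpa using hq0) ENNReal.ofReal_ne_top,
    ENNReal.toReal_ofReal hq0.le]
  calc (∫⁻ x, ‖g x‖ₑ ^ q ∂μ) ^ (1 / q)
      ≤ (∫⁻ x, M ^ (q - 2) * ‖g x‖ₑ ^ (2 : ℝ) ∂μ) ^ (1 / q) := by
        refine ENNReal.rpow_le_rpow (lintegral_mono_ae ?_) (by positivity)
        filter_upwards [hM] with x hx
        rw [show q = (q - 2) + 2 by ring,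
          ENNReal.rpow_add_of_nonneg _ _ (by linarith) (by norm_num)]
        rw [show q - 2 + 2 - 2 = q - 2 by ring]
        gcongr
    _ ≤ (M ^ (q - 2) * eLpNorm g 2 μ ^ (2 : ℝ)) ^ (1 / q) := by
        rw [lintegral_const_mul' _ _ (ENNReal.rpow_ne_top_of_nonneg (by linarith) hMt), h2]
    _ = _ := by
        rw [ENNReal.mul_rpow_of_nonneg _ _ (by positivity), ← ENNReal.rpow_mul,
          ← ENNReal.rpow_mul]
        congr 2 <;> field_simp
end Average

/-! ### Dyadic telescoping: approximation by averages in `L^q` -/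

section Dyadic

variable {E : Type*} [NormedAddCommGroup E] [NormedSpace ℝ E] [FiniteDimensional ℝ E]
  [MeasurableSpace E] [BorelSpace E] {μ : Measure E} [μ.IsAddHaarMeasure]

theorem eLpNorm_ballAverage_sub_le {f : E → ℝ} (hf : StronglyMeasurable f)
    (hfi : LocallyIntegrable f μ) {K : ℝ≥0∞}
    (hK : ∀ h, ∫⁻ x, ‖f (x + h) - f x‖ₑ ^ 2 ∂μ ≤ (K * ‖h‖ₑ) ^ 2) {r : ℝ} (hr : 0 < r) :
    eLpNorm (ballAverage μ f r - f) 2 μ ≤ K * ENNReal.ofReal r := by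
  rw [← ENNReal.pow_le_pow_left_iff two_ne_zero, eLpNorm_two_sq]
  exact lintegral_ballAverage_sub_sq_le hf hfi hK hr

theorem enorm_ballAverage_sub_ballAverage_half_le {f : E → ℝ} (hf : StronglyMeasurable f)
    (hfi : LocallyIntegrable f μ) {K : ℝ≥0∞}
    (hK : ∀ h, ∫⁻ x, ‖f (x + h) - f x‖ₑ ^ 2 ∂μ ≤ (K * ‖h‖ₑ) ^ 2) {r : ℝ} (hr : 0 < r) (x : E) :
    ‖ballAverage μ f r x - ballAverage μ f (r / 2) x‖ₑ ≤ K * ENNReal.ofReal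
      (√(4 ^ (Module.finrank ℝ E + 1) / μ.real (Metric.ball 0 1))
        * r ^ (1 - (Module.finrank ℝ E : ℝ) / 2)) := by
  set n := Module.finrank ℝ E with hn
  set b := μ.real (Metric.ball (0 : E) 1) with hb
  have hb0 : 0 < b := by
    rw [hb, Measure.real, ENNReal.toReal_pos_iff]
    exact ⟨Metric.measure_ball_pos μ 0 one_pos, measure_ball_lt_top⟩
  have hvol : ∀ t : ℝ, 0 < t → μ (Metric.ball (0 : E) t) = ENNReal.ofReal (t ^ n * b) := by
    intro t ht
    rw [Measure.addHaar_ball_of_pos μ 0 ht, ENNReal.ofReal_mul (by positivity), hb, Measure.real,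
      ENNReal.ofReal_toReal measure_ball_lt_top.ne]
  rw [← ENNReal.pow_le_pow_left_iff two_ne_zero]
  refine (enorm_ballAverage_sub_ballAverage_sq_le hf hfi hK hr (half_pos hr) x).trans ?_
  rw [hvol r hr, hvol (r / 2) (half_pos hr), mul_pow K, mul_pow K]
  have h2 : μ (Metric.ball (0 : E) (r + r / 2)) ≤ ENNReal.ofReal ((2 * r) ^ n * b) := by
    rw [← hvol (2 * r) (by positivity)]
    exact measure_mono (Metric.ball_subset_ball (by linarith))
  have h3 : ENNReal.ofReal (r + r / 2) ≤ ENNReal.ofReal (2 * r) :=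
    ENNReal.ofReal_le_ofReal (by linarith)
  have h4 : (r ^ (1 - (n : ℝ) / 2)) ^ 2 = r ^ 2 / r ^ n := by
    rw [← Real.rpow_natCast (r ^ _), ← Real.rpow_mul hr.le,
      show (1 - (n : ℝ) / 2) * (2 : ℕ) = (2 : ℕ) - n by push_cast; ring, Real.rpow_sub hr,
      Real.rpow_natCast, Real.rpow_natCast]
  calc _ ≤ (ENNReal.ofReal (r ^ n * b))⁻¹ * ((ENNReal.ofReal ((r / 2) ^ n * b))⁻¹ *
        (ENNReal.ofReal ((2 * r) ^ n * b) * (K ^ 2 * ENNReal.ofReal (2 * r) ^ 2))) := by gcongr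
    _ = K ^ 2 * ENNReal.ofReal ((r ^ n * b)⁻¹ * (((r / 2) ^ n * b)⁻¹ *
        (((2 * r) ^ n * b) * (2 * r) ^ 2))) := by
        rw [ENNReal.ofReal_mul (p := (r ^ n * b)⁻¹) (by positivity),
          ENNReal.ofReal_mul (p := ((r / 2) ^ n * b)⁻¹) (by positivity),
          ENNReal.ofReal_mul (p := (2 * r) ^ n * b) (by positivity),
          ENNReal.ofReal_inv_of_pos (by positivity), ENNReal.ofReal_inv_of_pos (by positivity),
          ENNReal.ofReal_pow (by positivity) 2]
        ring
    _ = _ := by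
        rw [← ENNReal.ofReal_pow (by positivity)]
        congr 2
        rw [mul_pow (√_), Real.sq_sqrt (by positivity), h4, pow_succ (4 : ℝ) n,
          show (4 : ℝ) = 2 * 2 by norm_num, mul_pow, mul_pow, mul_pow, div_pow]
        field_simp

theorem eLpNorm_ballAverage_sub_ballAverage_half_le {f : E → ℝ} (hf : StronglyMeasurable f)
    (hfi : LocallyIntegrable f μ) {K : ℝ≥0∞} (hKt : K ≠ ⊤)
    (hK : ∀ h, ∫⁻ x, ‖f (x + h) - f x‖ₑ ^ 2 ∂μ ≤ (K * ‖h‖ₑ) ^ 2) {r : ℝ} (hr : 0 < r)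
    {q : ℝ} (hq : 2 < q) :
    eLpNorm (ballAverage μ f r - ballAverage μ f (r / 2)) (ENNReal.ofReal q) μ
      ≤ K * ENNReal.ofReal
        (√(4 ^ (Module.finrank ℝ E + 1) / μ.real (Metric.ball 0 1)) ^ (1 - 2 / q) * 2 ^ (2 / q)
          * r ^ (1 - (Module.finrank ℝ E : ℝ) / 2 + Module.finrank ℝ E / q)) := by
  have hq0 : 0 < q := by linarith
  have hq1 : 0 ≤ 1 - 2 / q := by
    rw [sub_nonneg, div_le_one hq0]; exact hq.le
  have hL2 : eLpNorm (ballAverage μ f r - ballAverage μ f (r / 2)) 2 μ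
      ≤ K * ENNReal.ofReal (2 * r) := by
    have e : ballAverage μ f r - ballAverage μ f (r / 2)
        = (ballAverage μ f r - f) - (ballAverage μ f (r / 2) - f) := by abel
    rw [e]
    refine (eLpNorm_sub_le
      ((stronglyMeasurable_ballAverage hf).sub hf).aestronglyMeasurable
      ((stronglyMeasurable_ballAverage hf).sub hf).aestronglyMeasurable (by norm_num)).trans ?_
    refine (add_le_add (eLpNorm_ballAverage_sub_le hf hfi hK hr)
      (eLpNorm_ballAverage_sub_le hf hfi hK (half_pos hr))).trans ?_
    rw [← mul_add, ← ENNReal.ofReal_add hr.le (half_pos hr).le]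
    gcongr
    linarith
  set n := Module.finrank ℝ E with hn
  set C := √(4 ^ (n + 1) / μ.real (Metric.ball 0 1)) with hC
  have hC0 : 0 ≤ C := Real.sqrt_nonneg _
  have hrp : 0 ≤ r ^ (1 - (n : ℝ) / 2) := Real.rpow_nonneg hr.le _
  refine (eLpNorm_le_of_ae_enorm_le (M := K * ENNReal.ofReal (C * r ^ (1 - (n : ℝ) / 2)))
    (ENNReal.mul_ne_top hKt ENNReal.ofReal_ne_top) (Eventually.of_forall fun x =>
      enorm_ballAverage_sub_ballAverage_half_le hf hfi hK hr x) hq).trans ?_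
  calc _ ≤ (K * ENNReal.ofReal (C * r ^ (1 - (n : ℝ) / 2))) ^ (1 - 2 / q)
        * (K * ENNReal.ofReal (2 * r)) ^ (2 / q) :=
        mul_le_mul_right (ENNReal.rpow_le_rpow hL2 (by positivity)) _
    _ = K ^ (1 - 2 / q) * K ^ (2 / q) * ENNReal.ofReal
        ((C * r ^ (1 - (n : ℝ) / 2)) ^ (1 - 2 / q) * (2 * r) ^ (2 / q)) := by
        rw [ENNReal.mul_rpow_of_nonneg _ _ hq1, ENNReal.mul_rpow_of_nonneg _ _ (by positivity),
          ENNReal.ofReal_mul (p := (C * r ^ (1 - (n : ℝ) / 2)) ^ (1 - 2 / q)) (by positivity),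
          ENNReal.ofReal_rpow_of_nonneg (by positivity) hq1,
          ENNReal.ofReal_rpow_of_nonneg (by positivity) (by positivity)]
        ring
    _ = _ := by
        rw [← ENNReal.rpow_add_of_nonneg _ _ hq1 (by positivity),
          show 1 - 2 / q + 2 / q = 1 by ring, ENNReal.rpow_one]
        congr 2
        rw [Real.mul_rpow hC0 hrp, Real.mul_rpow (by norm_num) hr.le, ← Real.rpow_mul hr.le,
          show 1 - (n : ℝ) / 2 + n / q = (1 - (n : ℝ) / 2) * (1 - 2 / q) + 2 / q by
            field_simp; ring, Real.rpow_add hr]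
        ring

/-- Functions with `‖f(· + h) - f‖₂ ≤ K ‖h‖` are approximated in `L^q` by their averages over
balls of radius `2⁻ᵐ`, at a rate depending only on `K`, for `q` below the Sobolev exponent. The
exponent `1 - n / 2 + n / q` is the decay rate of the dyadic pieces. -/
theorem exists_eLpNorm_ballAverage_sub_le (μ : Measure E) [μ.IsAddHaarMeasure] {q : ℝ}
    (hq : 2 < q) (hα : 0 < 1 - (Module.finrank ℝ E : ℝ) / 2 + Module.finrank ℝ E / q) :
    ∃ δ : ℕ → ℝ≥0∞, (∀ m, δ m ≠ ⊤) ∧ Tendsto δ atTop (𝓝 0) ∧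
      ∀ (f : E → ℝ) (K : ℝ≥0∞), StronglyMeasurable f → LocallyIntegrable f μ → K ≠ ⊤ →
        (∀ h, ∫⁻ x, ‖f (x + h) - f x‖ₑ ^ 2 ∂μ ≤ (K * ‖h‖ₑ) ^ 2) →
        ∀ m, eLpNorm (ballAverage μ f ((1 / 2) ^ m) - f) (ENNReal.ofReal q) μ ≤ K * δ m := by
  set α := 1 - (Module.finrank ℝ E : ℝ) / 2 + Module.finrank ℝ E / q with hαdef
  set D := √(4 ^ (Module.finrank ℝ E + 1) / μ.real (Metric.ball (0 : E) 1)) ^ (1 - 2 / q)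
    * 2 ^ (2 / q) with hD
  have hD0 : 0 ≤ D := by positivity
  set ρ : ℝ≥0∞ := ENNReal.ofReal ((1 / 2) ^ α) with hρ
  have hρ1 : ρ < 1 := by
    rw [hρ, ← ENNReal.ofReal_one, ENNReal.ofReal_lt_ofReal_iff one_pos]
    exact Real.rpow_lt_one (by norm_num) (by norm_num) hα
  have hρi : (1 - ρ)⁻¹ ≠ ⊤ := ENNReal.inv_ne_top.2 (tsub_pos_of_lt hρ1).ne'
  refine ⟨fun m => ENNReal.ofReal D * (1 - ρ)⁻¹ * ρ ^ m, fun m => ?_, ?_, ?_⟩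
  · exact ENNReal.mul_ne_top (ENNReal.mul_ne_top ENNReal.ofReal_ne_top hρi)
      (ENNReal.pow_ne_top hρ1.ne_top)
  · have := ENNReal.Tendsto.const_mul (ENNReal.tendsto_pow_atTop_nhds_zero_of_lt_one hρ1)
      (Or.inr (ENNReal.mul_ne_top (ENNReal.ofReal_ne_top (r := D)) hρi))
    simpa using this
  intro f K hf hfi hKt hK m
  have hm : ∀ k, StronglyMeasurable (ballAverage μ f ((1 / 2) ^ k)) :=
    fun k => stronglyMeasurable_ballAverage hf
  have hq1 : 1 ≤ ENNReal.ofReal q := by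
    rw [ENNReal.one_le_ofReal]; linarith
  have hstep : ∀ k : ℕ, eLpNorm (ballAverage μ f ((1 / 2) ^ k) -
      ballAverage μ f ((1 / 2) ^ (k + 1))) (ENNReal.ofReal q) μ
        ≤ K * ENNReal.ofReal D * ρ ^ k := by
    intro k
    have h1 := eLpNorm_ballAverage_sub_ballAverage_half_le hf hfi hKt hK
      (r := (1 / 2) ^ k) (by positivity) hq
    rw [show ((1 / 2 : ℝ) ^ k) / 2 = (1 / 2) ^ (k + 1) by rw [pow_succ]; ring] at h1
    refine h1.trans_eq ?_
    rw [← hαdef, ← hD, ENNReal.ofReal_mul hD0, mul_assoc, hρ, ← ENNReal.ofReal_pow (by positivity),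
      ← Real.rpow_natCast, ← Real.rpow_natCast, ← Real.rpow_mul (by norm_num),
      ← Real.rpow_mul (by norm_num), mul_comm α]
  have hsum : ∀ j : ℕ, eLpNorm (ballAverage μ f ((1 / 2) ^ m) -
      ballAverage μ f ((1 / 2) ^ (m + j))) (ENNReal.ofReal q) μ
        ≤ K * (ENNReal.ofReal D * (1 - ρ)⁻¹ * ρ ^ m) := by
    intro j
    have e : ballAverage μ f ((1 / 2) ^ m) - ballAverage μ f ((1 / 2) ^ (m + j))
        = ∑ i ∈ Finset.range j, (ballAverage μ f ((1 / 2) ^ (m + i)) -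
          ballAverage μ f ((1 / 2) ^ (m + i + 1))) := by
      have := Finset.sum_range_sub' (fun i => ballAverage μ f ((1 / 2) ^ (m + i))) j
      simpa [add_assoc] using this.symm
    rw [e]
    calc _ ≤ ∑ i ∈ Finset.range j, K * ENNReal.ofReal D * ρ ^ (m + i) :=
          (eLpNorm_sum_le (fun i _ => ((hm _).sub (hm _)).aestronglyMeasurable) hq1).trans
            (Finset.sum_le_sum fun i _ => hstep (m + i))
      _ = K * ENNReal.ofReal D * ρ ^ m * ∑ i ∈ Finset.range j, ρ ^ i := by
          rw [Finset.mul_sum]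
          exact Finset.sum_congr rfl fun i _ => by rw [pow_add]; ring
      _ ≤ K * ENNReal.ofReal D * ρ ^ m * (1 - ρ)⁻¹ := by
          gcongr
          rw [← ENNReal.tsum_geometric]
          exact ENNReal.sum_le_tsum _
      _ = _ := by ring
  have hL2 : Tendsto (fun k : ℕ => eLpNorm (ballAverage μ f ((1 / 2) ^ k) - f) 2 μ) atTop
      (𝓝 0) := by
    have h0 : Tendsto (fun k : ℕ => K * ENNReal.ofReal ((1 / 2) ^ k)) atTop (𝓝 0) := by
      have h1 := ENNReal.tendsto_ofReal
        (tendsto_pow_atTop_nhds_zero_of_lt_one (r := (1 / 2 : ℝ)) (by norm_num) (by norm_num))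
      simpa using ENNReal.Tendsto.const_mul h1 (Or.inr hKt)
    exact tendsto_of_tendsto_of_tendsto_of_le_of_le tendsto_const_nhds h0 (fun _ => zero_le)
      fun k => eLpNorm_ballAverage_sub_le hf hfi hK (by positivity)
  obtain ⟨ns, hns, hae⟩ := (tendstoInMeasure_of_tendsto_eLpNorm (by norm_num)
    (fun k => (hm k).aestronglyMeasurable) hf.aestronglyMeasurable hL2).exists_seq_tendsto_ae
  refine (Lp.eLpNorm_lim_le_liminf_eLpNorm
    (f := fun j => ballAverage μ f ((1 / 2) ^ m) - ballAverage μ f ((1 / 2) ^ (ns j)))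
    (fun j => ((hm _).sub (hm _)).aestronglyMeasurable) _ ?_).trans ?_
  · filter_upwards [hae] with x hx
    exact tendsto_const_nhds.sub hx
  · refine liminf_le_of_frequently_le' (Eventually.frequently ?_)
    filter_upwards [eventually_ge_atTop m] with j hj
    obtain ⟨i, hi⟩ := Nat.exists_eq_add_of_le (hj.trans (hns.id_le j))
    change eLpNorm (ballAverage μ f ((1 / 2) ^ m) - ballAverage μ f ((1 / 2) ^ (ns j))) _ μ ≤ _
    rw [show ns j = m + i from hi]
    exact hsum i

end Dyadic

/-! ### Decay of symmetric functions by packing disjoint balls -/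

section Packing

/-- Packing: if `k` disjoint balls each carry at least the mass of `ball x ε`, then that mass is at
most `1 / k` of the total. -/
theorem mul_setLIntegral_ball_le_of_centers {E : Type*} [NormedAddCommGroup E] [MeasurableSpace E]
    [BorelSpace E] {μ : Measure E} {F : E → ℝ≥0∞} {x : E} {ε : ℝ} {k : ℕ} (c : ℕ → E)
    (hsep : ∀ m < k, ∀ l < k, m < l → 2 * ε ≤ dist (c m) (c l))
    (hle : ∀ m < k, ∫⁻ y in Metric.ball x ε, F y ∂μ ≤ ∫⁻ y in Metric.ball (c m) ε, F y ∂μ) :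
    k * ∫⁻ y in Metric.ball x ε, F y ∂μ ≤ ∫⁻ y, F y ∂μ := by
  have hdisj : (↑(Finset.range k) : Set ℕ).PairwiseDisjoint fun m => Metric.ball (c m) ε := by
    intro m hm l hl hml
    simp only [Finset.coe_range, Set.mem_Iio] at hm hl
    refine Metric.ball_disjoint_ball ?_
    rcases lt_or_gt_of_ne hml with h | h
    · linarith [hsep m hm l hl h]
    · rw [dist_comm]; linarith [hsep l hl m hm h]
  calc k * ∫⁻ y in Metric.ball x ε, F y ∂μ
      = ∑ m ∈ Finset.range k, ∫⁻ y in Metric.ball x ε, F y ∂μ := by simp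
    _ ≤ ∑ m ∈ Finset.range k, ∫⁻ y in Metric.ball (c m) ε, F y ∂μ :=
        Finset.sum_le_sum fun m hm => hle m (Finset.mem_range.1 hm)
    _ = ∫⁻ y in ⋃ m ∈ Finset.range k, Metric.ball (c m) ε, F y ∂μ :=
        (lintegral_biUnion_finset hdisj (fun _ _ => measurableSet_ball) _).symm
    _ ≤ ∫⁻ y, F y ∂μ := setLIntegral_le_lintegral _ _

theorem mul_setLIntegral_ball_le_of_translates {E : Type*} [NormedAddCommGroup E]
    [NormedSpace ℝ E] [MeasurableSpace E] [BorelSpace E] {μ : Measure E} [μ.IsAddHaarMeasure]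
    {F : E → ℝ≥0∞} {x e : E} {ε : ℝ} {k : ℕ} (hε : 2 * ε ≤ ‖e‖)
    (hle : ∀ m < k, ∀ᵐ y ∂μ, y ∈ Metric.ball x ε → F y ≤ F (y + (m : ℝ) • e)) :
    k * ∫⁻ y in Metric.ball x ε, F y ∂μ ≤ ∫⁻ y, F y ∂μ := by
  refine mul_setLIntegral_ball_le_of_centers (fun m => x + (m : ℝ) • e) ?_ ?_
  · intro m _ l _ hml
    rw [dist_add_left, dist_eq_norm, ← sub_smul, norm_smul, Real.norm_eq_abs, abs_sub_comm]
    have : (1 : ℝ) ≤ |(l : ℝ) - m| := by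
      refine le_trans ?_ (le_abs_self _)
      have : (m : ℝ) + 1 ≤ l := by exact_mod_cast hml
      linarith
    nlinarith [norm_nonneg e]
  · intro m hm
    have h := (measurePreserving_add_right μ ((m : ℝ) • e)).setLIntegral_comp_preimage_emb
      (measurableEmbedding_addRight _) F (Metric.ball (x + (m : ℝ) • e) ε)
    rw [← h]
    have hpre : (fun y => y + (m : ℝ) • e) ⁻¹' Metric.ball (x + (m : ℝ) • e) ε
        = Metric.ball x ε := by
      ext y
      simp
    rw [hpre]
    exact setLIntegral_mono_ae' measurableSet_ball (hle m hm)

theorem enorm_sq_le_pos_add_neg (t : ℝ) :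
    ‖t‖ₑ ^ 2 ≤ ENNReal.ofReal t ^ 2 + ENNReal.ofReal (-t) ^ 2 := by
  rcases le_total 0 t with h | h
  · rw [Real.enorm_eq_ofReal h]
    exact le_self_add
  · rw [← enorm_neg, Real.enorm_eq_ofReal (neg_nonneg.2 h)]
    exact le_add_self

theorem ofReal_le_enorm_self (t : ℝ) : ENNReal.ofReal t ≤ ‖t‖ₑ := by
  rw [← ofReal_norm]
  exact ENNReal.ofReal_le_ofReal (le_abs_self t)

/-- A function that is decreasing in `|x_i|` has little mass near points with `|x_i|` large: the
mass of its positive part near `x` is exceeded near each point obtained by moving `x` towards the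
hyperplane `x_i = 0`, and that of its negative part near each point further outwards. -/
theorem DecreasingAbsOn.mul_setLIntegral_ball_le {N : ℕ} {i : Fin N}
    {S : Set (EuclideanSpace ℝ (Fin N))} {f : EuclideanSpace ℝ (Fin N) → ℝ}
    (hf : StronglyMeasurable f) (hS : volume Sᶜ = 0) (hdec : DecreasingAbsOn i S f)
    {ε : ℝ} (hε : 0 < ε) (k : ℕ) (x : EuclideanSpace ℝ (Fin N))
    (hx : 2 * ε * k + ε ≤ |x i|) :
    k * ∫⁻ y in Metric.ball x ε, ‖f y‖ₑ ^ 2 ≤ 2 * ∫⁻ y, ‖f y‖ₑ ^ 2 := by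
  have hmem : ∀ a : ℝ, ∀ m : ℕ, ∀ᵐ y : EuclideanSpace ℝ (Fin N),
      y ∈ S ∧ y + (m : ℝ) • EuclideanSpace.single i a ∈ S := by
    intro a m
    have h1 : ∀ᵐ y : EuclideanSpace ℝ (Fin N), y ∈ S := hS
    exact h1.and ((measurePreserving_add_right volume
      ((m : ℝ) • EuclideanSpace.single i a)).quasiMeasurePreserving.ae h1)
  have hj : ∀ (a : ℝ) (m : ℕ) (y : EuclideanSpace ℝ (Fin N)) (j : Fin N), j ≠ i →
      y j = (y + (m : ℝ) • EuclideanSpace.single i a) j := by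
    intro a m y j hji
    simp [hji]
  have hi : ∀ (a : ℝ) (m : ℕ) (y : EuclideanSpace ℝ (Fin N)),
      (y + (m : ℝ) • EuclideanSpace.single i a) i = y i + m * a := by
    intro a m y
    simp
  have hball : ∀ y ∈ Metric.ball x ε, |y i - x i| < ε := by
    intro y hy
    exact (PiLp.norm_apply_le (y - x) i).trans_lt (mem_ball_iff_norm.1 hy)
  have hmk : ∀ m < k, (m : ℝ) * ε ≤ k * ε := by
    intro m hm
    gcongr
  -- The step `a` along the `i`-th axis points towards the hyperplane `x_i = 0`.
  have hpos : ∃ a : ℝ, |a| = 2 * ε ∧ ∀ m < k, ∀ y ∈ Metric.ball x ε,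
      |y i + m * a| ≤ |y i| ∧ |y i| ≤ |y i + m * -a| := by
    rcases le_total 0 (x i) with h | h
    · refine ⟨-(2 * ε), by rw [abs_neg, abs_of_pos (by positivity)], fun m hm y hy => ?_⟩
      rw [abs_of_nonneg h] at hx
      have h1 := abs_lt.1 (hball y hy)
      have h2 := hmk m hm
      have h3 : 0 ≤ (m : ℝ) * ε := by positivity
      rw [abs_of_nonneg (a := y i) (by nlinarith), abs_of_nonneg (by nlinarith),
        abs_of_nonneg (by nlinarith)]
      constructor <;> nlinarith
    · refine ⟨2 * ε, abs_of_pos (by positivity), fun m hm y hy => ?_⟩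
      rw [abs_of_nonpos h] at hx
      have h1 := abs_lt.1 (hball y hy)
      have h2 := hmk m hm
      have h3 : 0 ≤ (m : ℝ) * ε := by positivity
      rw [abs_of_nonpos (a := y i) (by nlinarith), abs_of_nonpos (by nlinarith),
        abs_of_nonpos (by nlinarith)]
      constructor <;> nlinarith
  obtain ⟨a, ha, hin⟩ := hpos
  have hp := mul_setLIntegral_ball_le_of_translates (μ := volume)
    (F := fun y => ENNReal.ofReal (f y) ^ 2) (x := x) (e := EuclideanSpace.single i a)
    (ε := ε) (k := k) (by simp [ha]) (by
      intro m hm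
      filter_upwards [hmem a m] with y hy hyb
      have := hdec _ hy.2 _ hy.1 (fun j hji => (hj a m y j hji).symm)
        (by rw [hi]; exact (hin m hm y hyb).1)
      gcongr)
  have hn := mul_setLIntegral_ball_le_of_translates (μ := volume)
    (F := fun y => ENNReal.ofReal (-f y) ^ 2) (x := x) (e := EuclideanSpace.single i (-a))
    (ε := ε) (k := k) (by simp [ha]) (by
      intro m hm
      filter_upwards [hmem (-a) m] with y hy hyb
      have := hdec _ hy.1 _ hy.2 (fun j hji => hj (-a) m y j hji)
        (by rw [hi]; exact (hin m hm y hyb).2)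
      gcongr)
  have hmeas : Measurable fun y => ENNReal.ofReal (f y) ^ 2 :=
    hf.measurable.ennreal_ofReal.pow_const 2
  calc k * ∫⁻ y in Metric.ball x ε, ‖f y‖ₑ ^ 2
      ≤ k * ∫⁻ y in Metric.ball x ε, (ENNReal.ofReal (f y) ^ 2 + ENNReal.ofReal (-f y) ^ 2) := by
        gcongr with y
        exact enorm_sq_le_pos_add_neg _
    _ = (k * ∫⁻ y in Metric.ball x ε, ENNReal.ofReal (f y) ^ 2)
        + k * ∫⁻ y in Metric.ball x ε, ENNReal.ofReal (-f y) ^ 2 := by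
        rw [lintegral_add_left hmeas, mul_add]
    _ ≤ (∫⁻ y, ENNReal.ofReal (f y) ^ 2) + ∫⁻ y, ENNReal.ofReal (-f y) ^ 2 := add_le_add hp hn
    _ ≤ (∫⁻ y, ‖f y‖ₑ ^ 2) + ∫⁻ y, ‖f y‖ₑ ^ 2 := by
        gcongr with y y
        · exact ofReal_le_enorm_self _
        · rw [← enorm_neg]; exact ofReal_le_enorm_self _
    _ = 2 * ∫⁻ y, ‖f y‖ₑ ^ 2 := (two_mul _).symm

/-- The rotation of `ℝ^N` with matrix `!![a, -b; b, a]` in the plane of the coordinates `i`, `j`. -/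
noncomputable def planeRotation {N : ℕ} {i j : Fin N} (hij : i ≠ j) {a b : ℝ}
    (hab : a ^ 2 + b ^ 2 = 1) :
    EuclideanSpace ℝ (Fin N) ≃ₗᵢ[ℝ] EuclideanSpace ℝ (Fin N) :=
  LinearIsometry.toLinearIsometryEquiv
    { toFun := fun x => WithLp.toLp 2 fun l =>
        if l = i then a * x i - b * x j else if l = j then b * x i + a * x j else x l
      map_add' := by
        intro x y
        ext l
        simp only [PiLp.add_apply]
        split_ifs <;> ring
      map_smul' := by
        intro c x
        ext l
        simp only [PiLp.smul_apply, smul_eq_mul, RingHom.id_apply]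
        split_ifs <;> ring
      norm_map' := by
        intro x
        rw [← sq_eq_sq₀ (norm_nonneg _) (norm_nonneg _), EuclideanSpace.real_norm_sq_eq,
          EuclideanSpace.real_norm_sq_eq, ← sub_eq_zero, ← Finset.sum_sub_distrib,
          Fintype.sum_eq_add i j hij]
        · simp [hij.symm]
          linear_combination (x i ^ 2 + x j ^ 2) * hab
        · rintro l ⟨h1, h2⟩
          simp [h1, h2] } rfl

theorem planeRotation_apply {N : ℕ} {i j : Fin N} (hij : i ≠ j) {a b : ℝ}
    (hab : a ^ 2 + b ^ 2 = 1) (x : EuclideanSpace ℝ (Fin N)) (l : Fin N) :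
    planeRotation hij hab x l =
      if l = i then a * x i - b * x j else if l = j then b * x i + a * x j else x l := rfl

theorem RadialFirstOn.setLIntegral_ball_planeRotation {N d : ℕ}
    {S : Set (EuclideanSpace ℝ (Fin N))} {f : EuclideanSpace ℝ (Fin N) → ℝ}
    (hS : volume Sᶜ = 0) (hrad : RadialFirstOn d S f) {i j : Fin N} (hij : i ≠ j)
    (hi : i.val < d) (hj : j.val < d) {a b : ℝ} (hab : a ^ 2 + b ^ 2 = 1)
    (ε : ℝ) (x : EuclideanSpace ℝ (Fin N)) :
    ∫⁻ y in Metric.ball (planeRotation hij hab x) ε, ‖f y‖ₑ ^ 2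
      = ∫⁻ y in Metric.ball x ε, ‖f y‖ₑ ^ 2 := by
  set T := planeRotation hij hab with hT
  have hmp : MeasurePreserving T volume volume := T.measurePreserving
  rw [← hmp.setLIntegral_comp_preimage_emb T.toHomeomorph.measurableEmbedding
    (fun y => ‖f y‖ₑ ^ 2), T.preimage_ball, T.symm_apply_apply]
  refine lintegral_congr_ae (ae_restrict_of_ae ?_)
  have h1 : ∀ᵐ y : EuclideanSpace ℝ (Fin N), y ∈ S := hS
  filter_upwards [h1, hmp.quasiMeasurePreserving.ae h1] with y hy hTy
  rw [hrad _ hTy _ hy]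
  · rw [← sub_eq_zero, ← Finset.sum_sub_distrib, Finset.sum_eq_add i j hij]
    · simp only [hT, planeRotation_apply, hij.symm, if_true, if_false]
      linear_combination (y i ^ 2 + y j ^ 2) * hab
    · rintro l - ⟨h2, h3⟩
      simp [hT, planeRotation_apply, h2, h3]
    · intro h; simp [hi] at h
    · intro h; simp [hj] at h
  · intro l hl
    have h2 : l ≠ i := by rintro rfl; omega
    have h3 : l ≠ j := by rintro rfl; omega
    simp [hT, planeRotation_apply, h2, h3]

/-- A function that is radial in the first `d ≥ 2` coordinates has little mass near points where
one of these is large: rotations produce many disjoint balls carrying the same mass. -/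
theorem RadialFirstOn.mul_setLIntegral_ball_le {N d : ℕ}
    {S : Set (EuclideanSpace ℝ (Fin N))} {f : EuclideanSpace ℝ (Fin N) → ℝ}
    (hS : volume Sᶜ = 0) (hrad : RadialFirstOn d S f) {i j : Fin N} (hij : i ≠ j)
    (hi : i.val < d) (hj : j.val < d) {ε : ℝ} (hε : 0 < ε) (k : ℕ)
    (x : EuclideanSpace ℝ (Fin N)) (hx : ε * (1 + k ^ 2) ≤ |x i|) :
    k * ∫⁻ y in Metric.ball x ε, ‖f y‖ₑ ^ 2 ≤ ∫⁻ y, ‖f y‖ₑ ^ 2 := by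
  -- The rational points of the unit circle: those with parameters `m ≠ l` have squared distance
  -- `4 (m - l) ^ 2 / ((1 + m ^ 2) * (1 + l ^ 2))`.
  have hab : ∀ m : ℕ, ((1 - (m : ℝ) ^ 2) / (1 + m ^ 2)) ^ 2 + (2 * m / (1 + m ^ 2)) ^ 2 = 1 := by
    intro m
    field_simp
    ring
  refine mul_setLIntegral_ball_le_of_centers (fun m => planeRotation hij (hab m) x) ?_ ?_
  · intro m hm l hl hml
    set v := planeRotation hij (hab m) x - planeRotation hij (hab l) x with hv
    have hvi : v i = ((1 - (m : ℝ) ^ 2) / (1 + m ^ 2) - (1 - (l : ℝ) ^ 2) / (1 + l ^ 2)) * x i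
        - (2 * m / (1 + m ^ 2) - 2 * l / (1 + l ^ 2)) * x j := by
      simp only [hv, PiLp.sub_apply, planeRotation_apply, if_true]; ring
    have hvj : v j = (2 * m / (1 + m ^ 2) - 2 * l / (1 + l ^ 2)) * x i
        + ((1 - (m : ℝ) ^ 2) / (1 + m ^ 2) - (1 - (l : ℝ) ^ 2) / (1 + l ^ 2)) * x j := by
      simp only [hv, PiLp.sub_apply, planeRotation_apply, hij.symm, if_true, if_false]; ring
    have hsum : v i ^ 2 + v j ^ 2 ≤ ‖v‖ ^ 2 := by
      rw [EuclideanSpace.real_norm_sq_eq, ← Finset.sum_pair (f := fun l => v l ^ 2) hij]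
      exact Finset.sum_le_sum_of_subset_of_nonneg (Finset.subset_univ _)
        fun _ _ _ => sq_nonneg _
    have heq : v i ^ 2 + v j ^ 2 = 4 * ((l : ℝ) - m) ^ 2 / ((1 + m ^ 2) * (1 + l ^ 2))
        * (x i ^ 2 + x j ^ 2) := by
      rw [hvi, hvj]
      field_simp
      ring
    have h1 : (1 : ℝ) ≤ ((l : ℝ) - m) ^ 2 := by
      have : (m : ℝ) + 1 ≤ l := by exact_mod_cast hml
      nlinarith
    have h2 : (1 + (m : ℝ) ^ 2) * (1 + (l : ℝ) ^ 2) ≤ (1 + (k : ℝ) ^ 2) ^ 2 := by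
      rw [sq (1 + (k : ℝ) ^ 2)]
      have : (m : ℝ) ≤ k := by exact_mod_cast hm.le
      have : (l : ℝ) ≤ k := by exact_mod_cast hl.le
      gcongr
    have h3 : (ε * (1 + (k : ℝ) ^ 2)) ^ 2 ≤ x i ^ 2 + x j ^ 2 := by
      rw [← sq_abs (x i)]
      have : (ε * (1 + (k : ℝ) ^ 2)) ^ 2 ≤ |x i| ^ 2 := by gcongr
      nlinarith [sq_nonneg (x j)]
    rw [dist_eq_norm, ← hv]
    refine le_of_sq_le_sq ?_ (norm_nonneg v)
    refine le_trans ?_ hsum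
    rw [heq]
    calc (2 * ε) ^ 2 = 4 * 1 / (1 + (k : ℝ) ^ 2) ^ 2 * (ε * (1 + (k : ℝ) ^ 2)) ^ 2 := by
          field_simp; ring
      _ ≤ _ := by gcongr
  · intro m _
    exact (hrad.setLIntegral_ball_planeRotation hS hij hi hj (hab m) ε x).ge

/-- The decay estimate: far out, a ball of radius `ε` carries at most a fraction `2 / k` of the
total mass, because some coordinate is large there. The radius depends on `N`, `ε`, `k` only. -/
theorem IsPartiallySymmetric.mul_setLIntegral_ball_le {N d : ℕ} (hd : 2 ≤ d) (hdN : d < N)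
    {f : EuclideanSpace ℝ (Fin N) → ℝ} (hf : StronglyMeasurable f)
    (hsymm : IsPartiallySymmetric d f) {ε : ℝ} (hε : 0 < ε) (k : ℕ)
    (x : EuclideanSpace ℝ (Fin N)) (hx : N * (ε * (1 + k) ^ 2) ≤ ‖x‖) :
    k * ∫⁻ y in Metric.ball x ε, ‖f y‖ₑ ^ 2 ≤ 2 * ∫⁻ y, ‖f y‖ₑ ^ 2 := by
  obtain ⟨S, hS, hrad, hdec⟩ := hsymm
  have hi : ∃ i : Fin N, ε * (1 + k) ^ 2 ≤ |x i| := by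
    by_contra! hlt
    have h1 : ‖x‖ ≤ ∑ i, |x i| := by
      conv_lhs => rw [← (EuclideanSpace.basisFun (Fin N) ℝ).sum_repr x]
      refine (norm_sum_le _ _).trans_eq (Finset.sum_congr rfl fun i _ => ?_)
      simp [norm_smul]
    have h2 : ∑ i, |x i| < ∑ _i : Fin N, ε * (1 + (k : ℝ)) ^ 2 :=
      Finset.sum_lt_sum_of_nonempty ⟨⟨0, by omega⟩, Finset.mem_univ _⟩ fun i _ => hlt i
    simp only [Finset.sum_const, Finset.card_univ, Fintype.card_fin, nsmul_eq_mul] at h2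
    linarith
  obtain ⟨i, hi⟩ := hi
  have hk : (0 : ℝ) ≤ k := k.cast_nonneg
  rcases lt_or_ge i.val d with hid | hid
  · obtain ⟨j, hij, hj⟩ : ∃ j : Fin N, i ≠ j ∧ j.val < d := by
      by_cases h0 : i.val = 0
      · exact ⟨⟨1, by omega⟩, fun h => by simp [h] at h0, by simp; omega⟩
      · exact ⟨⟨0, by omega⟩, fun h => by simp [h] at h0, by simp; omega⟩
    refine (hrad.mul_setLIntegral_ball_le hS hij hid hj hε k x ?_).trans ?_
    · nlinarith [mul_nonneg hε.le hk]
    · exact le_mul_of_one_le_left' one_le_two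
  · refine (hdec i hid).mul_setLIntegral_ball_le hf hS hε k x ?_
    nlinarith [mul_nonneg hε.le (sq_nonneg (k : ℝ))]

end Packing

/-! ### Strong convergence -/

section Convergence

/-- Pointwise convergence to `0`, together with uniform decay at infinity and bounds in `L^∞` and
`L²`, gives convergence to `0` in `L^q` for `q > 2`. -/
theorem tendsto_eLpNorm_zero_of_uniform_decay {E : Type*} [NormedAddCommGroup E] [ProperSpace E]
    [MeasurableSpace E] [BorelSpace E] {μ : Measure E} [IsFiniteMeasureOnCompacts μ]
    {w : ℕ → E → ℝ} (hw : ∀ n, StronglyMeasurable (w n))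
    (hlim : ∀ x, Tendsto (fun n => w n x) atTop (𝓝 0)) {M M₂ : ℝ≥0∞} (hMt : M ≠ ⊤)
    (hM : ∀ n x, ‖w n x‖ₑ ≤ M) (hM₂t : M₂ ≠ ⊤) (hM₂ : ∀ n, eLpNorm (w n) 2 μ ≤ M₂)
    (hdecay : ∀ η : ℝ≥0∞, 0 < η → ∃ R : ℝ, ∀ n x, R ≤ ‖x‖ → ‖w n x‖ₑ ≤ η)
    {q : ℝ} (hq : 2 < q) :
    Tendsto (fun n => eLpNorm (w n) (ENNReal.ofReal q) μ) atTop (𝓝 0) := by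
  have hq0 : 0 < q := by linarith
  have hq1 : 0 < 1 - 2 / q := by
    rw [sub_pos, div_lt_one hq0]; exact hq
  rw [ENNReal.tendsto_nhds_zero]
  intro e he
  have he2 : 0 < e / 2 := ENNReal.half_pos he.ne'
  obtain ⟨η, hη0, hηt, hη⟩ : ∃ η : ℝ≥0∞, 0 < η ∧ η ≠ ⊤ ∧
      η ^ (1 - 2 / q) * M₂ ^ (2 / q) ≤ e / 2 := by
    have h1 : Tendsto (fun η : ℝ≥0∞ => η ^ (1 - 2 / q) * M₂ ^ (2 / q)) (𝓝[>] 0) (𝓝 0) := by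
      have h2 := (ENNReal.continuous_rpow_const (y := 1 - 2 / q)).tendsto 0
      rw [ENNReal.zero_rpow_of_pos hq1] at h2
      have h3 := ENNReal.Tendsto.mul_const h2
        (Or.inr (ENNReal.rpow_ne_top_of_nonneg (y := 2 / q) (by positivity) hM₂t))
      rw [zero_mul] at h3
      exact h3.mono_left nhdsWithin_le_nhds
    have h4 : ∀ᶠ η : ℝ≥0∞ in 𝓝[>] 0, η < ⊤ :=
      nhdsWithin_le_nhds (Iio_mem_nhds ENNReal.zero_lt_top)
    obtain ⟨η, h5, h6, h7⟩ :=
      ((ENNReal.tendsto_nhds_zero.1 h1 _ he2).and (h4.and self_mem_nhdsWithin)).exists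
    exact ⟨η, h7, h6.ne, h5⟩
  obtain ⟨R, hR⟩ := hdecay η hη0
  have hin : Tendsto (fun n => eLpNorm (w n) (ENNReal.ofReal q) (μ.restrict (Metric.ball 0 R)))
      atTop (𝓝 0) := by
    have h1 : Tendsto (fun n => ∫⁻ x in Metric.ball 0 R, ‖w n x‖ₑ ^ q ∂μ) atTop
        (𝓝 (∫⁻ x in Metric.ball 0 R, 0 ∂μ)) := by
      refine tendsto_lintegral_of_dominated_convergence (fun _ => M ^ q)
        (fun n => (hw n).measurable.enorm.pow_const q) (fun n => Eventually.of_forall fun x =>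
          ENNReal.rpow_le_rpow (hM n x) hq0.le) ?_ (Eventually.of_forall fun x => ?_)
      · rw [setLIntegral_const]
        exact ENNReal.mul_ne_top (ENNReal.rpow_ne_top_of_nonneg hq0.le hMt)
          measure_ball_lt_top.ne
      · have h2 := ((ENNReal.continuous_rpow_const (y := q)).comp continuous_enorm).tendsto (0 : ℝ)
        have h3 := h2.comp (hlim x)
        simpa [Function.comp_def, ENNReal.zero_rpow_of_pos hq0] using h3
    rw [lintegral_zero] at h1
    have h2 := ((ENNReal.continuous_rpow_const (y := 1 / q)).tendsto 0).comp h1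
    rw [ENNReal.zero_rpow_of_pos (by positivity)] at h2
    refine h2.congr fun n => ?_
    rw [eLpNorm_eq_lintegral_rpow_enorm_toReal (by simpa using hq0) ENNReal.ofReal_ne_top,
      ENNReal.toReal_ofReal hq0.le]
    rfl
  have hout : ∀ n, eLpNorm (w n) (ENNReal.ofReal q) (μ.restrict (Metric.ball 0 R)ᶜ) ≤ e / 2 := by
    intro n
    refine (eLpNorm_le_of_ae_enorm_le hηt ?_ hq).trans (le_trans ?_ hη)
    · refine (ae_restrict_iff' measurableSet_ball.compl).2 (Eventually.of_forall fun x hx => ?_)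
      exact hR n x (by simpa using hx)
    · gcongr
      exact (eLpNorm_mono_measure _ Measure.restrict_le_self).trans (hM₂ n)
  filter_upwards [ENNReal.tendsto_nhds_zero.1 hin _ he2] with n hn
  have hsplit : w n = (Metric.ball 0 R).indicator (w n) + (Metric.ball 0 R)ᶜ.indicator (w n) :=
    (Set.indicator_self_add_compl _ _).symm
  rw [hsplit]
  refine (eLpNorm_add_le ((hw n).indicator measurableSet_ball).aestronglyMeasurable
    ((hw n).indicator measurableSet_ball.compl).aestronglyMeasurable
    (by rw [ENNReal.one_le_ofReal]; linarith)).trans ?_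
  rw [eLpNorm_indicator_eq_eLpNorm_restrict measurableSet_ball,
    eLpNorm_indicator_eq_eLpNorm_restrict measurableSet_ball.compl]
  exact (add_le_add hn (hout n)).trans_eq (ENNReal.add_halves e)

variable {N : ℕ}

theorem H1Space.stronglyMeasurable_toFun (u : H1Space N) : StronglyMeasurable u.toFun :=
  Lp.stronglyMeasurable (u.1.fst : L2Space N)

theorem H1Space.locallyIntegrable_toFun (u : H1Space N) : LocallyIntegrable u.toFun volume :=
  (Lp.memLp (u.1.fst : L2Space N)).locallyIntegrable (by norm_num)

theorem H1Space.eLpNorm_toFun_le (u : H1Space N) {C : ℝ} (hC : ‖u‖ ≤ C) :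
    eLpNorm u.toFun 2 volume ≤ ENNReal.ofReal C := by
  refine le_trans (le_of_eq ?_) (ENNReal.ofReal_le_ofReal (u.norm_fst_le.trans hC))
  rw [ofReal_norm, Lp.enorm_def]
  rfl

theorem H1Space.lintegral_translate_sub_sq_le (u : H1Space N) {C : ℝ} (hC : ‖u‖ ≤ C)
    (h : EuclideanSpace ℝ (Fin N)) :
    ∫⁻ x, ‖u.toFun (x + h) - u.toFun x‖ₑ ^ 2 ≤ (ENNReal.ofReal (N * C) * ‖h‖ₑ) ^ 2 := by
  rw [← eLpNorm_two_sq (fun x => u.toFun (x + h) - u.toFun x)]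
  gcongr
  refine (u.eLpNorm_translate_sub_le h).trans ?_
  rw [← ofReal_norm, ← ENNReal.ofReal_mul (by have := (norm_nonneg u).trans hC; positivity)]
  gcongr

theorem H1Space.eLpNorm_ballAverage_le (u : H1Space N) {C : ℝ} (hC : ‖u‖ ≤ C) {r : ℝ}
    (hr : 0 < r) :
    eLpNorm (ballAverage volume u.toFun r) 2 volume
      ≤ ENNReal.ofReal (N * C) * ENNReal.ofReal r + ENNReal.ofReal C := by
  have hf := u.stronglyMeasurable_toFun
  have e : ballAverage volume u.toFun r
      = (ballAverage volume u.toFun r - u.toFun) + u.toFun := by abel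
  rw [e]
  exact (eLpNorm_add_le ((stronglyMeasurable_ballAverage hf).sub hf).aestronglyMeasurable
    hf.aestronglyMeasurable (by norm_num)).trans (add_le_add
      (eLpNorm_ballAverage_sub_le hf u.locallyIntegrable_toFun
        (u.lintegral_translate_sub_sq_le hC) hr) (u.eLpNorm_toFun_le hC))

theorem H1Space.exists_enorm_ballAverage_le (C : ℝ) {r : ℝ} (hr : 0 < r) :
    ∃ M : ℝ≥0∞, M ≠ ⊤ ∧ ∀ (u : H1Space N) (x : EuclideanSpace ℝ (Fin N)), ‖u‖ ≤ C →
      ‖ballAverage volume u.toFun r x‖ₑ ≤ M := by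
  set b := volume (Metric.ball (0 : EuclideanSpace ℝ (Fin N)) r) with hb
  have hbi : b⁻¹ ≠ ⊤ := ENNReal.inv_ne_top.2 (Metric.measure_ball_pos volume 0 hr).ne'
  refine ⟨(b⁻¹ * ENNReal.ofReal C ^ 2) ^ (1 / 2 : ℝ), ENNReal.rpow_ne_top_of_nonneg (by norm_num)
    (ENNReal.mul_ne_top hbi (ENNReal.pow_ne_top ENNReal.ofReal_ne_top)), fun u x hC => ?_⟩
  rw [← ENNReal.pow_le_pow_left_iff two_ne_zero, ← ENNReal.rpow_natCast (_ ^ _),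
    ← ENNReal.rpow_mul, show (1 / 2 : ℝ) * (2 : ℕ) = 1 by norm_num, ENNReal.rpow_one]
  refine (enorm_ballAverage_sq_le u.stronglyMeasurable_toFun x).trans ?_
  refine mul_le_mul_right ((setLIntegral_le_lintegral _ _).trans ?_) _
  rw [← eLpNorm_two_sq]
  gcongr
  exact u.eLpNorm_toFun_le hC

theorem H1WeakTendsto.tendsto_ballAverage {u : ℕ → H1Space N} {v : H1Space N}
    (hweak : H1WeakTendsto u v) (r : ℝ) (x : EuclideanSpace ℝ (Fin N)) :
    Tendsto (fun n => ballAverage volume (u n).toFun r x) atTop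
      (𝓝 (ballAverage volume v.toFun r x)) := by
  have hfin : volume (Metric.ball x r) ≠ ⊤ := measure_ball_lt_top.ne
  set l : H1Space N →L[ℝ] ℝ :=
    (innerSL ℝ (indicatorConstLp 2 measurableSet_ball hfin (1 : ℝ) : L2Space N)).comp
      ((WithLp.fstL 2 ℝ (L2Space N) (PiLp 2 fun _ : Fin N => L2Space N)).comp
        (sobolevH1 N).subtypeL) with hl
  have hlu : ∀ w : H1Space N, l w = ∫ y in Metric.ball x r, w.toFun y := fun w =>
    L2.inner_indicatorConstLp_one measurableSet_ball hfin (w.1.fst : L2Space N)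
  simp only [ballAverage_eq, ← hlu]
  exact (hweak l).const_mul _

/-- Averages over balls of a fixed radius turn weak into strong convergence. -/
theorem tendsto_eLpNorm_ballAverage_sub {d : ℕ} (hd : 2 ≤ d) (hdN : d < N) {u : ℕ → H1Space N}
    {v : H1Space N} {C : ℝ} (hu : ∀ n, ‖u n‖ ≤ C) (hv : ‖v‖ ≤ C)
    (hsymm : ∀ n, IsPartiallySymmetric d (u n).toFun) (hweak : H1WeakTendsto u v)
    {q : ℝ} (hq : 2 < q) {r : ℝ} (hr : 0 < r) :
    Tendsto (fun n => eLpNorm (ballAverage volume (u n).toFun r - ballAverage volume v.toFun r)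
      (ENNReal.ofReal q) volume) atTop (𝓝 0) := by
  set b := volume (Metric.ball (0 : EuclideanSpace ℝ (Fin N)) r) with hb
  have hbi : b⁻¹ ≠ ⊤ := ENNReal.inv_ne_top.2 (Metric.measure_ball_pos volume 0 hr).ne'
  have hmeas : ∀ w : H1Space N, StronglyMeasurable (ballAverage volume w.toFun r) :=
    fun w => stronglyMeasurable_ballAverage w.stronglyMeasurable_toFun
  -- Bounds on the averages of `u n` that hold at a point for every `n` pass to those of `v`.
  have hsub : ∀ (x : EuclideanSpace ℝ (Fin N)) (η : ℝ≥0∞),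
      (∀ n, ‖ballAverage volume (u n).toFun r x‖ₑ ≤ η) →
      ∀ n, ‖(ballAverage volume (u n).toFun r - ballAverage volume v.toFun r) x‖ₑ ≤ η + η := by
    intro x η h n
    have hlim := le_of_tendsto (hweak.tendsto_ballAverage r x).enorm (Eventually.of_forall h)
    exact (enorm_sub_le).trans (add_le_add (h n) hlim)
  have hC2 : ENNReal.ofReal C ≠ ⊤ := ENNReal.ofReal_ne_top
  obtain ⟨M, hMt, hM⟩ := H1Space.exists_enorm_ballAverage_le (N := N) C hr
  refine tendsto_eLpNorm_zero_of_uniform_decay (fun n => (hmeas _).sub (hmeas _)) (fun x => ?_)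
    (M := M + M)
    (M₂ := (ENNReal.ofReal (N * C) * ENNReal.ofReal r + ENNReal.ofReal C) +
      (ENNReal.ofReal (N * C) * ENNReal.ofReal r + ENNReal.ofReal C))
    ?_ (fun n x => ?_) ?_ (fun n => ?_) (fun η hη => ?_) hq
  · simpa using (hweak.tendsto_ballAverage r x).sub_const (ballAverage volume v.toFun r x)
  · exact ENNReal.add_ne_top.2 ⟨hMt, hMt⟩
  · exact hsub x _ (fun n => hM (u n) x (hu n)) n
  · have : ENNReal.ofReal (N * C) * ENNReal.ofReal r + ENNReal.ofReal C ≠ ⊤ :=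
      ENNReal.add_ne_top.2 ⟨ENNReal.mul_ne_top ENNReal.ofReal_ne_top ENNReal.ofReal_ne_top, hC2⟩
    exact ENNReal.add_ne_top.2 ⟨this, this⟩
  · exact (eLpNorm_sub_le (hmeas _).aestronglyMeasurable (hmeas _).aestronglyMeasurable
      (by norm_num)).trans (add_le_add ((u n).eLpNorm_ballAverage_le (hu n) hr)
        (v.eLpNorm_ballAverage_le hv hr))
  · -- The packing bound at multiplicity `k` makes the averages `O(k ^ (-1/2))` far out.
    set D := b⁻¹ * (2 * ENNReal.ofReal C ^ 2) with hD
    have hDt : D ≠ ⊤ := ENNReal.mul_ne_top hbi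
      (ENNReal.mul_ne_top ENNReal.ofNat_ne_top (ENNReal.pow_ne_top hC2))
    have hη2 : 0 < η / 2 := ENNReal.half_pos hη.ne'
    obtain ⟨k, hk⟩ : ∃ k : ℕ, D / (k + 1 : ℕ) ≤ (η / 2) ^ 2 := by
      have h1 : Tendsto (fun k : ℕ => D / ((k + 1 : ℕ) : ℝ≥0∞)) atTop (𝓝 0) := by
        have h2 := ENNReal.Tendsto.const_mul
          ((tendsto_add_atTop_iff_nat 1).2 ENNReal.tendsto_inv_nat_nhds_zero) (Or.inr hDt)
        simpa [div_eq_mul_inv] using h2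
      exact (ENNReal.tendsto_nhds_zero.1 h1 _ (by positivity)).exists
    refine ⟨N * (r * (1 + (k + 1 : ℕ)) ^ 2), fun n x hx => ?_⟩
    rw [← ENNReal.add_halves η]
    refine hsub x (η / 2) (fun n => ?_) n
    rw [← ENNReal.pow_le_pow_left_iff two_ne_zero]
    refine (enorm_ballAverage_sq_le (u n).stronglyMeasurable_toFun x).trans
      (le_trans ?_ hk)
    have h1 := (hsymm n).mul_setLIntegral_ball_le hd hdN (u n).stronglyMeasurable_toFun hr
      (k + 1) x hx
    have h2 : ∫⁻ y, ‖(u n).toFun y‖ₑ ^ 2 ≤ ENNReal.ofReal C ^ 2 := by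
      rw [← eLpNorm_two_sq]
      gcongr
      exact (u n).eLpNorm_toFun_le (hu n)
    rw [ENNReal.le_div_iff_mul_le (Or.inl (by simp)) (Or.inl (ENNReal.natCast_ne_top _)), hD,
      mul_assoc]
    refine mul_le_mul_right ?_ _
    rw [mul_comm]
    exact h1.trans (mul_le_mul_right h2 _)

end Convergence

theorem proposition2p1 (N d : ℕ) (hd : 2 ≤ d) (hdN : d < N)
    (u : ℕ → H1Space N) (v : H1Space N)
    (hbdd : ∃ C : ℝ, ∀ n, ‖u n‖ ≤ C)
    (hsymm : ∀ n, IsPartiallySymmetric d (u n).toFun)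
    (hweak : H1WeakTendsto u v)
    (q : ℝ) (hq : 2 < q) (hq' : q < 2 * (N : ℝ) / ((N : ℝ) - 2)) :
    (∀ n, MemLp (u n).toFun (ENNReal.ofReal q) volume) ∧
      MemLp v.toFun (ENNReal.ofReal q) volume ∧
      Tendsto (fun n => eLpNorm (fun x => (u n).toFun x - v.toFun x) (ENNReal.ofReal q) volume)
        atTop (𝓝 0) := by
  obtain ⟨C₀, hC₀⟩ := hbdd
  set C := max C₀ ‖v‖ with hC
  have hu : ∀ n, ‖u n‖ ≤ C := fun n => (hC₀ n).trans (le_max_left _ _)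
  have hv : ‖v‖ ≤ C := le_max_right _ _
  have hq0 : 0 < q := by linarith
  have hq1 : 1 ≤ ENNReal.ofReal q := by
    rw [ENNReal.one_le_ofReal]; linarith
  have hN : (2 : ℝ) < N := by exact_mod_cast hd.trans_lt hdN
  have hα : 0 < 1 - (Module.finrank ℝ (EuclideanSpace ℝ (Fin N)) : ℝ) / 2 +
      Module.finrank ℝ (EuclideanSpace ℝ (Fin N)) / q := by
    rw [lt_div_iff₀ (by linarith)] at hq'
    rw [finrank_euclideanSpace_fin,
      show 1 - (N : ℝ) / 2 + N / q = (2 * N - q * (N - 2)) / (2 * q) by field_simp; ring]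
    exact div_pos (by linarith) (by positivity)
  obtain ⟨δ, hδt, hδ, happ⟩ := exists_eLpNorm_ballAverage_sub_le
    (volume : Measure (EuclideanSpace ℝ (Fin N))) hq hα
  set K := ENNReal.ofReal (N * C) with hK
  have hKt : K ≠ ⊤ := ENNReal.ofReal_ne_top
  have happ' : ∀ w : H1Space N, ‖w‖ ≤ C → ∀ m, eLpNorm (ballAverage volume w.toFun ((1 / 2) ^ m) -
      w.toFun) (ENNReal.ofReal q) volume ≤ K * δ m := fun w hw m =>
    happ w.toFun K w.stronglyMeasurable_toFun w.locallyIntegrable_toFun hKt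
      (w.lintegral_translate_sub_sq_le hw) m
  have hav : ∀ (w : H1Space N) (r : ℝ), StronglyMeasurable (ballAverage volume w.toFun r) :=
    fun w r => stronglyMeasurable_ballAverage w.stronglyMeasurable_toFun
  have hmem : ∀ w : H1Space N, ‖w‖ ≤ C → MemLp w.toFun (ENNReal.ofReal q) volume := by
    intro w hw
    have h1 : MemLp (ballAverage volume w.toFun ((1 / 2) ^ 0)) (ENNReal.ofReal q) volume := by
      refine ⟨(hav w _).aestronglyMeasurable, ?_⟩
      obtain ⟨M, hMt, hM⟩ := H1Space.exists_enorm_ballAverage_le (N := N) C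
        (r := (1 / 2) ^ 0) (by positivity)
      refine (eLpNorm_le_of_ae_enorm_le hMt (Eventually.of_forall fun x => hM w x hw) hq).trans_lt
        (ENNReal.mul_lt_top ?_ ?_)
      · refine (ENNReal.rpow_ne_top_of_nonneg ?_ hMt).lt_top
        rw [sub_nonneg, div_le_one hq0]
        exact hq.le
      · refine (ENNReal.rpow_ne_top_of_nonneg (by positivity) ?_).lt_top
        refine ((w.eLpNorm_ballAverage_le hw (by positivity)).trans_lt ?_).ne
        exact ENNReal.add_lt_top.2 ⟨ENNReal.mul_lt_top ENNReal.ofReal_lt_top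
          ENNReal.ofReal_lt_top, ENNReal.ofReal_lt_top⟩
    have h2 : MemLp (ballAverage volume w.toFun ((1 / 2) ^ 0) - w.toFun) (ENNReal.ofReal q)
        volume :=
      ⟨((hav w _).sub w.stronglyMeasurable_toFun).aestronglyMeasurable,
        (happ' w hw 0).trans_lt (ENNReal.mul_lt_top hKt.lt_top (hδt 0).lt_top)⟩
    simpa using h1.sub h2
  refine ⟨fun n => hmem _ (hu n), hmem v hv, ?_⟩
  rw [ENNReal.tendsto_nhds_zero]
  intro e he
  obtain ⟨m, hm⟩ : ∃ m, K * δ m ≤ e / 3 := by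
    have h1 := ENNReal.Tendsto.const_mul hδ (Or.inr hKt)
    rw [mul_zero] at h1
    exact (ENNReal.tendsto_nhds_zero.1 h1 _ (ENNReal.div_pos he.ne' (by simp))).exists
  have hmid := tendsto_eLpNorm_ballAverage_sub hd hdN hu hv hsymm hweak hq
    (r := (1 / 2) ^ m) (by positivity)
  filter_upwards [ENNReal.tendsto_nhds_zero.1 hmid _
    (ENNReal.div_pos he.ne' (by simp : (3 : ℝ≥0∞) ≠ ⊤))] with n hn
  have hsplit : (fun x => (u n).toFun x - v.toFun x)
      = (ballAverage volume (u n).toFun ((1 / 2) ^ m) - ballAverage volume v.toFun ((1 / 2) ^ m))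
        + (ballAverage volume v.toFun ((1 / 2) ^ m) - v.toFun)
        - (ballAverage volume (u n).toFun ((1 / 2) ^ m) - (u n).toFun) := by
    ext x
    simp only [Pi.add_apply, Pi.sub_apply]
    ring
  have hm1 := ((hav (u n) ((1 / 2) ^ m)).sub (hav v ((1 / 2) ^ m))).aestronglyMeasurable
    (μ := volume)
  have hm2 := ((hav v ((1 / 2) ^ m)).sub v.stronglyMeasurable_toFun).aestronglyMeasurable
    (μ := volume)
  have hm3 := ((hav (u n) ((1 / 2) ^ m)).sub
    (u n).stronglyMeasurable_toFun).aestronglyMeasurable (μ := volume)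
  rw [hsplit]
  refine (eLpNorm_sub_le (hm1.add hm2) hm3 hq1).trans ?_
  refine (add_le_add (eLpNorm_add_le hm1 hm2 hq1) le_rfl).trans ?_
  refine (add_le_add (add_le_add hn ((happ' v hv m).trans hm))
    ((happ' (u n) (hu n) m).trans hm)).trans_eq ?_
  exact ENNReal.add_thirds e
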